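/- Let $\Theta=(\theta_1,\dots,\theta_4)\in\mathbb R^4$ with $1,\theta_1,\dots,\theta_4$ linearly independent over $\mathbb Z$. Let $\|\cdot\|$ be the distance to the nearest integer and, for $t\ge 1$, $\psi_\Theta(t)=\min_{1\le q\le t}\max_j\|q\theta_j\|$ ($q$ an integer). Put $$\omega=\sup\{\gamma:\liminf_{t\to\infty}t^\gamma\psi_\Theta(t)<\infty\}\in[0,+\infty],\qquad \hat\omega=\sup\{\gamma:\limsup_{t\to\infty}t^\gamma\psi_\Theta(t)<\infty\}\in[\tfrac14,1].$$ Let $\mathbf z_\nu=(q_\nu,a_{1,\nu},\dots,a_{4,\nu})\in\mathbb Z^5$, $\nu=0,1,2,\dots$, be the sequence of all best approximations to $\Theta$: $q_0<q_1<\cdots$ are all positive integers $q$ such that $\max_j\|q\theta_j\|<\max_j\|x\theta_j\|$ for all integers $1\le x<q$, and $a_{j,\nu}$ is the integer nearest to $q_\nu\theta_j$. The index $\mathfrak i(\Theta)$ is the least $n$ for which there is a sequence (in $l$) of tuples of indices $1\le\nu=r_0<r_1<\cdots<r_n<r_{n+1}=k$ such that (i) $\nu\to\infty$ as $l\to\infty$;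 (ii) $\mathbf z_{r_i-1},\mathbf z_{r_i},\mathbf z_{r_i+1}$ are linearly independent for $0\le i\le n+1$; (iii) for $0\le i\le n$ the vectors $\mathbf z_{r_i},\mathbf z_{r_i+1},\dots,\mathbf z_{r_{i+1}}$ lie in one two-dimensional linear subspace; (iv) there is a three-dimensional subspace $T$ with $T=\mathrm{span}(\mathbf z_{r_i-1},\mathbf z_{r_i},\mathbf z_{r_i+1})$ for $1\le i\le n$; (v) $\mathbf z_{\nu-1}\notin T$ and $\mathbf z_{k+1}\notin T$; (vi) the five vectors $\mathbf z_{\nu-1},\mathbf z_{r_n-1},\mathbf z_{k-1},\mathbf z_k,\mathbf z_{k+1}$ are linearly independent; and $\mathfrak i(\Theta)=\infty$ if there is no such $n$. For $w\in[\frac14,1)$ put $\beta=\frac{w}{1-w}$ and $$f_1(x)=x^3-\beta x^2-\beta x-\beta,\qquad f_{2,1}(x)=x^4-\beta x^3-\beta x^2+\beta^2x-\tfrac{w}{(1-w)^2},$$ $$f_{2,2}(x)=x^4-\beta x^3-\beta x^2+\beta x-\tfrac{w}{(1-w)^2},\qquad f_3(x)=x^5-\beta x^4-\beta x^3+\beta^2x^2-\tfrac{w}{(1-w)^2}.$$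 Let $G_1(w)$ be the unique positive root of $f_1$; let $G_2(w)$ be the unique positive root of $f_{2,1}$ if $w\le\frac12$ and of $f_{2,2}$ if $w\ge\frac12$; let $G_3(w)$ be the largest positive root of $f_3$. Put $G_i(1)=+\infty$. (The existence of these roots, and uniqueness for $G_1$ and $G_2$, at $w=\hat\omega$ is part of the claim.) **Theorem 1.** For each $i\in\{1,2,3\}$: if $\mathfrak i(\Theta)=i$, then $\omega\ge\hat\omega\,G_i(\hat\omega)$. In particular, if $\mathfrak i(\Theta)\in\{1,2,3\}$ and $\hat\omega=1$, then $\omega=+\infty$. -/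

import Mathlib

open Filter

namespace DiophantineFour

/-- `max_j ‖q θ_j‖`, where `‖·‖` is the distance to the nearest integer
(the norm on `Fin 4 → ℝ` is the maximum norm). -/
noncomputable def distInt (Θ : Fin 4 → ℝ) (q : ℕ) : ℝ :=
  ‖(fun j => (q : ℝ) * Θ j - (round ((q : ℝ) * Θ j) : ℝ) : Fin 4 → ℝ)‖

/-- The irrationality measure function `ψ_Θ(t)`: the minimum of `max_j ‖q θ_j‖` over the positive
integers `q ≤ t` (only the values for `t ≥ 1` matter). -/
noncomputable def psi (Θ : Fin 4 → ℝ) (t : ℝ) : ℝ :=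
  sInf {x : ℝ | ∃ q : ℕ, 1 ≤ q ∧ (q : ℝ) ≤ t ∧ x = distInt Θ q}

/-- The ordinary exponent `ω(Θ)`, possibly `+∞`. -/
noncomputable def ordinaryExponent (Θ : Fin 4 → ℝ) : EReal :=
  sSup {e : EReal | ∃ γ : ℝ, e = (γ : EReal) ∧
    liminf (fun t : ℝ => ((t ^ γ * psi Θ t : ℝ) : EReal)) atTop < ⊤}

/-- The uniform exponent `ω̂(Θ)`. -/
noncomputable def uniformExponent (Θ : Fin 4 → ℝ) : EReal :=
  sSup {e : EReal | ∃ γ : ℝ, e = (γ : EReal) ∧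
    limsup (fun t : ℝ => ((t ^ γ * psi Θ t : ℝ) : EReal)) atTop < ⊤}

/-- `q` is the denominator of a best approximation to `Θ`. -/
def IsBestDenominator (Θ : Fin 4 → ℝ) (q : ℕ) : Prop :=
  1 ≤ q ∧ ∀ x : ℕ, 1 ≤ x → x < q → distInt Θ q < distInt Θ x

/-- The increasing sequence `q_0 < q_1 < ...` of all denominators of best approximations
(there are infinitely many of them as soon as some `θ_j` is irrational). -/
noncomputable def bestDenom (Θ : Fin 4 → ℝ) (ν : ℕ) : ℕ :=
  Nat.nth (IsBestDenominator Θ) ν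

/-- The best approximation vector `z_ν = (q_ν, a_{1,ν}, ..., a_{4,ν})`, where `a_{j,ν}` is the
integer nearest to `q_ν θ_j`, regarded as a vector in `ℝ⁵`. -/
noncomputable def bestVec (Θ : Fin 4 → ℝ) (ν : ℕ) : Fin 5 → ℝ :=
  Fin.cons (bestDenom Θ ν : ℝ) fun j : Fin 4 => (round ((bestDenom Θ ν : ℝ) * Θ j) : ℝ)

/-- A configuration `ν = r 0 < r 1 < ... < r n < r (n + 1) = k` of indices of best approximations.
Only the values `r 0, ..., r (n + 1)` matter. -/
structure IsConfiguration (Θ : Fin 4 → ℝ) (n : ℕ) (r : ℕ → ℕ) : Prop where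
  one_le : 1 ≤ r 0
  lt_succ : ∀ i ≤ n, r i < r (i + 1)
  /-- the triples `z_{r_i - 1}, z_{r_i}, z_{r_i + 1}` are linearly independent -/
  triple_indep : ∀ i ≤ n + 1, LinearIndependent ℝ
    ![bestVec Θ (r i - 1), bestVec Θ (r i), bestVec Θ (r i + 1)]
  /-- `z_{r_i}, z_{r_i + 1}, ..., z_{r_{i+1}}` lie in one two-dimensional subspace -/
  planes : ∀ i ≤ n, ∃ L : Submodule ℝ (Fin 5 → ℝ), Module.finrank ℝ L = 2 ∧
    ∀ j, r i ≤ j → j ≤ r (i + 1) → bestVec Θ j ∈ L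
  /-- the interior triples span one three-dimensional subspace, which contains neither
  `z_{ν - 1}` nor `z_{k + 1}` -/
  space : ∃ T : Submodule ℝ (Fin 5 → ℝ), Module.finrank ℝ T = 3 ∧
    (∀ i, 1 ≤ i → i ≤ n →
      Submodule.span ℝ {bestVec Θ (r i - 1), bestVec Θ (r i), bestVec Θ (r i + 1)} = T) ∧
    bestVec Θ (r 0 - 1) ∉ T ∧ bestVec Θ (r (n + 1) + 1) ∉ T
  /-- the five vectors `z_{ν-1}, z_{r_n - 1}, z_{k-1}, z_k, z_{k+1}` are linearly independent
  (as a family, which excludes `n = 0`) -/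
  five_indep : LinearIndependent ℝ
    ![bestVec Θ (r 0 - 1), bestVec Θ (r n - 1), bestVec Θ (r (n + 1) - 1),
      bestVec Θ (r (n + 1)), bestVec Θ (r (n + 1) + 1)]

/-- There is a sequence of configurations `(ν, r_1, ..., r_n, k)_l` with `ν_l → ∞`. -/
def HasConfigurations (Θ : Fin 4 → ℝ) (n : ℕ) : Prop :=
  ∃ R : ℕ → ℕ → ℕ, Tendsto (fun l => R l 0) atTop atTop ∧ ∀ l, IsConfiguration Θ n (R l)

/-- The index of `Θ`: the least `n` such that there is a sequence of configurations of length `n`,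
and `∞` if there is no such `n`. -/
noncomputable def index (Θ : Fin 4 → ℝ) : ℕ∞ :=
  ⨅ (n : ℕ) (_ : HasConfigurations Θ n), (n : ℕ∞)

/-- The cubic `f₁`, with parameter `w`. -/
noncomputable def f₁ (w x : ℝ) : ℝ :=
  x ^ 3 - w / (1 - w) * x ^ 2 - w / (1 - w) * x - w / (1 - w)

/-- The quartic `f₂,₁`, with parameter `w`. -/
noncomputable def f₂₁ (w x : ℝ) : ℝ :=
  x ^ 4 - w / (1 - w) * x ^ 3 - w / (1 - w) * x ^ 2 + (w / (1 - w)) ^ 2 * x - w / (1 - w) ^ 2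

/-- The quartic `f₂,₂`, with parameter `w`. -/
noncomputable def f₂₂ (w x : ℝ) : ℝ :=
  x ^ 4 - w / (1 - w) * x ^ 3 - w / (1 - w) * x ^ 2 + w / (1 - w) * x - w / (1 - w) ^ 2

/-- The quintic `f₃`, with parameter `w`. -/
noncomputable def f₃ (w x : ℝ) : ℝ :=
  x ^ 5 - w / (1 - w) * x ^ 4 - w / (1 - w) * x ^ 3 + w ^ 2 / (1 - w) ^ 2 * x ^ 2 - w / (1 - w) ^ 2

/-- `G` is the unique positive root of `f`. -/
def IsUniquePosRoot (f : ℝ → ℝ) (G : ℝ) : Prop :=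
  0 < G ∧ f G = 0 ∧ ∀ x, 0 < x → f x = 0 → x = G

/-- `G` is the largest positive root of `f`. -/
def IsLargestPosRoot (f : ℝ → ℝ) (G : ℝ) : Prop :=
  IsGreatest {x : ℝ | 0 < x ∧ f x = 0} G

end DiophantineFour

namespace DiophantineFour

/-! ### Distance to the nearest integers and the sequence of best approximations -/

variable {Θ : Fin 4 → ℝ}

/-! The bound with the root of `f₁` holds for every length `n ≥ 1`; the other polynomials only give
weaker bounds, because each of them is nonnegative at the root of `f₁` and so has its relevant root
no further right.

Write `X_i` for the best denominators, `L_i` for their distances, `p = r_0 - 1`, `a = r_1 - 1`, `k =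
r_{n+1}`. A configuration yields two inequalities (`exists_estimates`). Volume: `z_p, z_a, z_{a+1},
z_{a+2}, z_{k+1}` have a nonzero integer determinant, and clearing the first coordinates of the
outer two with `z_k` gives `X_k ≪ L_p L_a L_{a+1} X_{a+2} L_k X_{k+1}`. Area: `z_{p+1}, z_{p+2}` and
`z_a, z_{a+1}` span the same plane, and a consecutive pair is a basis of the integer points there,
so `L_a X_{a+1} ≪ L_{p+1} X_{p+2}`.

In logarithms these are linear, as are `L_i ≤ X_{i+1}^{-α}` for `α < ω̂` and `L_i ≥ X_i^{-αg}` for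
`αg > ω`. Eliminating everything but `log L_{p+1}` leaves a multiple of `-f₁ α g` times an unbounded
quantity below a constant, so `f₁ α g ≥ 0` (`f₁_nonneg_of_estimates`, `f₁_nonneg`). Letting `α` tend
to `ω̂` gives the theorem. -/

theorem distInt_nonneg (Θ : Fin 4 → ℝ) (q : ℕ) : 0 ≤ distInt Θ q := norm_nonneg _

/-- The nearest integers give the smallest distance. -/
theorem distInt_le_norm (Θ : Fin 4 → ℝ) (q : ℕ) (m : Fin 4 → ℤ) :
    distInt Θ q ≤ ‖(fun j => (q : ℝ) * Θ j - (m j : ℝ) : Fin 4 → ℝ)‖ := by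
  refine (pi_norm_le_iff_of_nonneg (norm_nonneg _)).2 fun j => ?_
  refine le_trans ?_ (norm_le_pi_norm _ j)
  simpa only [Real.norm_eq_abs] using round_le ((q : ℝ) * Θ j) (m j)

theorem distInt_le_half (Θ : Fin 4 → ℝ) (q : ℕ) : distInt Θ q ≤ 1 / 2 :=
  (pi_norm_le_iff_of_nonneg (by norm_num)).2 fun _ => by
    simpa only [Real.norm_eq_abs] using abs_sub_round _

theorem distInt_pos (hΘ : LinearIndependent ℤ (Fin.cons 1 Θ : Fin 5 → ℝ)) {q : ℕ} (hq : 1 ≤ q) :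
    0 < distInt Θ q := by
  refine lt_of_le_of_ne (distInt_nonneg _ _) fun h => ?_
  have h0 := congrFun (norm_eq_zero.1 h.symm) 0
  simp only [Pi.zero_apply] at h0
  have := Fintype.linearIndependent_iff.1 hΘ
    ![-round ((q : ℝ) * Θ 0), (q : ℤ), 0, 0, 0] (by
      simp [Fin.sum_univ_succ]
      linarith) 1
  simp at this
  omega

/-- Dirichlet's theorem on simultaneous approximation. -/
theorem exists_distInt_le (Θ : Fin 4 → ℝ) {N : ℕ} (hN : 1 ≤ N) :
    ∃ q : ℕ, 1 ≤ q ∧ q ≤ N ^ 4 ∧ distInt Θ q ≤ 1 / N := by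
  have hN' : (0 : ℝ) < N := by exact_mod_cast hN
  have key : ∀ x : ℝ, ⌊Int.fract x * N⌋₊ < N := fun x => by
    rw [Nat.floor_lt (mul_nonneg (Int.fract_nonneg _) hN'.le)]
    nlinarith [Int.fract_lt_one x]
  let f : ℕ → (Fin 4 → Fin N) := fun q j => ⟨⌊Int.fract ((q : ℝ) * Θ j) * N⌋₊, key _⟩
  obtain ⟨a, ha, b, hb, hab, hf⟩ := Finset.exists_ne_map_eq_of_card_lt_of_maps_to
    (s := Finset.range (N ^ 4 + 1)) (t := Finset.univ) (f := f) (by simp)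
    (fun _ _ => Finset.mem_coe.2 (Finset.mem_univ _))
  wlog hlt : a < b generalizing a b
  · exact this b hb a ha hab.symm hf.symm (lt_of_le_of_ne (not_lt.1 hlt) hab.symm)
  refine ⟨b - a, by omega, by simp at hb; omega, ?_⟩
  refine (distInt_le_norm Θ (b - a) fun j => ⌊(b : ℝ) * Θ j⌋ - ⌊(a : ℝ) * Θ j⌋).trans ?_
  refine (pi_norm_le_iff_of_nonneg (by positivity)).2 fun j => ?_
  have hj : ⌊Int.fract ((a : ℝ) * Θ j) * N⌋₊ = ⌊Int.fract ((b : ℝ) * Θ j) * N⌋₊ :=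
    congrArg Fin.val (congrFun hf j)
  have h1 := Nat.floor_le (mul_nonneg (Int.fract_nonneg ((a : ℝ) * Θ j)) hN'.le)
  have h2 := Nat.lt_floor_add_one (Int.fract ((a : ℝ) * Θ j) * N)
  have h3 := Nat.floor_le (mul_nonneg (Int.fract_nonneg ((b : ℝ) * Θ j)) hN'.le)
  have h4 := Nat.lt_floor_add_one (Int.fract ((b : ℝ) * Θ j) * N)
  rw [hj] at h1 h2
  have e : ((b - a : ℕ) : ℝ) * Θ j - ((⌊(b : ℝ) * Θ j⌋ - ⌊(a : ℝ) * Θ j⌋ : ℤ) : ℝ) =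
      Int.fract ((b : ℝ) * Θ j) - Int.fract ((a : ℝ) * Θ j) := by
    rw [Nat.cast_sub hlt.le, Int.fract, Int.fract]
    push_cast
    ring
  rw [e, Real.norm_eq_abs, le_div_iff₀ hN', ← abs_of_pos hN', ← abs_mul, abs_le]
  constructor <;> nlinarith

theorem exists_isBestDenominator_le (Θ : Fin 4 → ℝ) {x : ℕ} (hx : 1 ≤ x) :
    ∃ y ≤ x, IsBestDenominator Θ y ∧ distInt Θ y ≤ distInt Θ x := by
  induction x using Nat.strong_induction_on with
  | _ x ih =>
    by_cases h : IsBestDenominator Θ x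
    · exact ⟨x, le_rfl, h, le_rfl⟩
    · simp only [IsBestDenominator, hx, true_and, not_forall, not_lt] at h
      obtain ⟨y, hy1, hyx, hle⟩ := h
      obtain ⟨z, hz, hzb, hzd⟩ := ih y hyx hy1
      exact ⟨z, hz.trans hyx.le, hzb, hzd.trans hle⟩

/-- If all best denominators were at most `B`, the distances up to `B` would have a positive
minimum, against Dirichlet's theorem. -/
theorem infinite_isBestDenominator (hΘ : LinearIndependent ℤ (Fin.cons 1 Θ : Fin 5 → ℝ)) :
    {q | IsBestDenominator Θ q}.Infinite := by
  refine Set.infinite_of_not_bddAbove ?_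
  rintro ⟨B, hB⟩
  obtain ⟨δ, hδ, hδB⟩ : ∃ δ > 0, ∀ y, 1 ≤ y → y ≤ B → δ ≤ distInt Θ y := by
    rcases Nat.eq_zero_or_pos B with rfl | hB0
    · exact ⟨1, one_pos, fun y h1 h2 => by omega⟩
    · obtain ⟨y, hy, hmin⟩ := (Finset.Icc 1 B).exists_min_image (distInt Θ) ⟨1, by simp; omega⟩
      exact ⟨_, distInt_pos hΘ (Finset.mem_Icc.1 hy).1, fun z h1 h2 =>
        hmin z (Finset.mem_Icc.2 ⟨h1, h2⟩)⟩
  obtain ⟨N, hN⟩ := exists_nat_one_div_lt hδ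
  obtain ⟨q, hq1, -, hq⟩ := exists_distInt_le Θ (Nat.succ_pos N)
  obtain ⟨y, -, hyb, hyd⟩ := exists_isBestDenominator_le Θ hq1
  have := hδB y hyb.1 (hB hyb)
  push_cast at hq
  linarith

section Sequence

variable (hΘ : LinearIndependent ℤ (Fin.cons 1 Θ : Fin 5 → ℝ))
include hΘ

theorem isBestDenominator_bestDenom (ν : ℕ) : IsBestDenominator Θ (bestDenom Θ ν) :=
  Nat.nth_mem_of_infinite (infinite_isBestDenominator hΘ) ν

theorem bestDenom_strictMono : StrictMono (bestDenom Θ) :=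
  Nat.nth_strictMono (infinite_isBestDenominator hΘ)

theorem one_le_bestDenom (ν : ℕ) : 1 ≤ bestDenom Θ ν := (isBestDenominator_bestDenom hΘ ν).1

theorem distInt_bestDenom_pos (ν : ℕ) : 0 < distInt Θ (bestDenom Θ ν) :=
  distInt_pos hΘ (one_le_bestDenom hΘ ν)

theorem distInt_bestDenom_strictAnti : StrictAnti fun ν => distInt Θ (bestDenom Θ ν) :=
  fun i j hij => (isBestDenominator_bestDenom hΘ j).2 _ (one_le_bestDenom hΘ i)
    (bestDenom_strictMono hΘ hij)

/-- No positive integer below `q_{ν+1}` approximates better than `q_ν`. -/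
theorem distInt_bestDenom_le {ν x : ℕ} (hx : 1 ≤ x) (hlt : x < bestDenom Θ (ν + 1)) :
    distInt Θ (bestDenom Θ ν) ≤ distInt Θ x := by
  obtain ⟨y, hyx, hyb, hyd⟩ := exists_isBestDenominator_le Θ hx
  obtain ⟨i, rfl⟩ : ∃ i, bestDenom Θ i = y := by
    have : y ∈ Set.range (bestDenom Θ) := by
      unfold bestDenom
      rw [Nat.range_nth_of_infinite (infinite_isBestDenominator hΘ)]
      exact hyb
    exact this
  have hi : i ≤ ν := by
    have := (bestDenom_strictMono hΘ).lt_iff_lt.1 (hyx.trans_lt hlt)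
    omega
  exact ((distInt_bestDenom_strictAnti hΘ).antitone hi).trans hyd

end Sequence

/-! ### The exponents in terms of best approximations -/

theorem psi_le {t : ℝ} {q : ℕ} (hq : 1 ≤ q) (hqt : (q : ℝ) ≤ t) : psi Θ t ≤ distInt Θ q :=
  csInf_le ⟨0, by rintro _ ⟨_, _, _, rfl⟩; exact distInt_nonneg _ _⟩ ⟨q, hq, hqt, rfl⟩

theorem le_psi {t c : ℝ} (ht : 1 ≤ t) (h : ∀ q : ℕ, 1 ≤ q → (q : ℝ) ≤ t → c ≤ distInt Θ q) :
    c ≤ psi Θ t :=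
  le_csInf ⟨_, 1, le_rfl, by simpa using ht, rfl⟩
    (by rintro _ ⟨q, h1, h2, rfl⟩; exact h q h1 h2)

/-- Dirichlet's theorem with `N = ⌊t^(1/4)⌋`; rounding down costs at most a factor 2. -/
theorem quarter_le_uniformExponent (Θ : Fin 4 → ℝ) :
    ((1 / 4 : ℝ) : EReal) ≤ uniformExponent Θ := by
  refine le_sSup ⟨1 / 4, rfl, ?_⟩
  refine lt_of_le_of_lt (limsup_le_of_le (a := ((2 : ℝ) : EReal)) (by isBoundedDefault) ?_)
    (EReal.coe_lt_top 2)
  filter_upwards [eventually_ge_atTop 1] with t ht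
  rw [EReal.coe_le_coe_iff]
  set s : ℝ := t ^ (1 / 4 : ℝ) with hs
  have hs1 : 1 ≤ s := Real.one_le_rpow ht (by norm_num)
  have hs4 : s ^ 4 = t := by
    rw [hs, ← Real.rpow_natCast, ← Real.rpow_mul (by linarith)]
    norm_num
  have hN : 1 ≤ ⌊s⌋₊ := Nat.one_le_floor_iff _ |>.2 hs1
  have hNs : (⌊s⌋₊ : ℝ) ≤ s := Nat.floor_le (by linarith)
  have hsN := Nat.lt_floor_add_one s
  have hN' : (1 : ℝ) ≤ ⌊s⌋₊ := by exact_mod_cast hN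
  obtain ⟨q, hq1, hq2, hq⟩ := exists_distInt_le Θ hN
  have hqt : (q : ℝ) ≤ t := by
    rw [← hs4]
    calc (q : ℝ) ≤ (⌊s⌋₊ : ℝ) ^ 4 := by exact_mod_cast hq2
      _ ≤ s ^ 4 := by gcongr
  calc s * psi Θ t ≤ s * (1 / ⌊s⌋₊) := by
        gcongr
        exact (psi_le hq1 hqt).trans hq
    _ ≤ 2 := by
        rw [mul_one_div, div_le_iff₀ (by linarith)]
        linarith

/-- Below the uniform exponent, consecutive best approximations satisfy
`max_j ‖q_ν θ_j‖ ≤ q_{ν+1}^{-α}` from some point on. -/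
theorem eventually_mul_log_le (hΘ : LinearIndependent ℤ (Fin.cons 1 Θ : Fin 5 → ℝ)) {α : ℝ}
    (hα : (α : EReal) < uniformExponent Θ) :
    ∀ᶠ ν in atTop, α * Real.log (bestDenom Θ (ν + 1)) ≤ -Real.log (distInt Θ (bestDenom Θ ν)) := by
  obtain ⟨_, ⟨γ, rfl, hγ⟩, hαγ⟩ := lt_sSup_iff.1 hα
  rw [EReal.coe_lt_coe_iff] at hαγ
  obtain ⟨C, hC, -⟩ := EReal.lt_iff_exists_real_btwn.1 hγ
  have hev := eventually_lt_of_limsup_lt hC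
  have hq : Tendsto (fun ν => (bestDenom Θ (ν + 1) : ℝ)) atTop atTop :=
    tendsto_natCast_atTop_atTop.comp
      ((bestDenom_strictMono hΘ).tendsto_atTop.comp (tendsto_add_atTop_nat 1))
  have hlog := (Real.tendsto_log_atTop.comp hq).const_mul_atTop (sub_pos.2 hαγ)
  filter_upwards [(hq.atTop_div_const two_pos).eventually hev,
    hq.eventually_ge_atTop 2,
    hlog.eventually_ge_atTop (γ * Real.log 2 + Real.log (max C 1))] with ν h1 h2 h3
  rw [EReal.coe_lt_coe_iff] at h1
  set X : ℝ := (bestDenom Θ (ν + 1) : ℝ) with hX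
  -- Below `X` the minimum is still the distance at `q_ν`. Testing at `X / 2` instead of just below
  -- `X` costs a constant factor, absorbed by the gap `α < γ`.
  have hpsi : distInt Θ (bestDenom Θ ν) ≤ psi Θ (X / 2) := by
    refine le_psi (by linarith) fun q hq1 hq2 => distInt_bestDenom_le hΘ hq1 ?_
    have : (q : ℝ) < (bestDenom Θ (ν + 1) : ℝ) := by rw [← hX]; linarith
    exact_mod_cast this
  have hL := distInt_bestDenom_pos hΘ ν
  have hp : 0 < (X / 2) ^ γ := Real.rpow_pos_of_pos (by linarith) _
  have h4 : (X / 2) ^ γ * distInt Θ (bestDenom Θ ν) ≤ max C 1 :=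
    ((mul_le_mul_of_nonneg_left hpsi hp.le).trans h1.le).trans (le_max_left _ _)
  have h5 := Real.log_le_log (by positivity) h4
  rw [Real.log_mul hp.ne' hL.ne', Real.log_rpow (by linarith),
    Real.log_div (by linarith) two_ne_zero] at h5
  simp only [Function.comp] at h3
  linarith

/-- Above the ordinary exponent, `max_j ‖q_ν θ_j‖ ≥ q_ν^{-γ}` from some point on. -/
theorem eventually_le_mul_log (hΘ : LinearIndependent ℤ (Fin.cons 1 Θ : Fin 5 → ℝ)) {γ : ℝ}
    (hγ : ordinaryExponent Θ < (γ : EReal)) :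
    ∀ᶠ ν in atTop, -Real.log (distInt Θ (bestDenom Θ ν)) ≤ γ * Real.log (bestDenom Θ ν) := by
  have htop : ((1 : ℝ) : EReal) <
      liminf (fun t : ℝ => ((t ^ γ * psi Θ t : ℝ) : EReal)) atTop := by
    by_contra h
    exact absurd hγ (not_lt.2 (le_sSup ⟨γ, rfl, (not_lt.1 h).trans_lt (EReal.coe_lt_top 1)⟩))
  have hev := eventually_lt_of_lt_liminf htop
  have hq : Tendsto (fun ν => (bestDenom Θ ν : ℝ)) atTop atTop :=
    tendsto_natCast_atTop_atTop.comp (bestDenom_strictMono hΘ).tendsto_atTop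
  filter_upwards [hq.eventually hev] with ν h1
  rw [EReal.coe_lt_coe_iff] at h1
  have hX : (1 : ℝ) ≤ bestDenom Θ ν := by exact_mod_cast one_le_bestDenom hΘ ν
  have hL := distInt_bestDenom_pos hΘ ν
  have hp : 0 < (bestDenom Θ ν : ℝ) ^ γ := Real.rpow_pos_of_pos (by linarith) _
  have h2 : 1 ≤ (bestDenom Θ ν : ℝ) ^ γ * distInt Θ (bestDenom Θ ν) :=
    h1.le.trans (mul_le_mul_of_nonneg_left (psi_le (one_le_bestDenom hΘ ν) le_rfl) hp.le)
  have h3 := Real.log_le_log one_pos h2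
  rw [Real.log_one, Real.log_mul hp.ne' hL.ne', Real.log_rpow (by linarith)] at h3
  linarith

/-! ### Error vectors and a determinant bound -/

/-- The error vector `(q_ν θ_j - a_{j,ν})_j` of a best approximation. -/
noncomputable def bestErr (Θ : Fin 4 → ℝ) (ν : ℕ) : Fin 4 → ℝ := fun j =>
  (bestDenom Θ ν : ℝ) * Θ j - (round ((bestDenom Θ ν : ℝ) * Θ j) : ℝ)

theorem norm_bestErr (Θ : Fin 4 → ℝ) (ν : ℕ) : ‖bestErr Θ ν‖ = distInt Θ (bestDenom Θ ν) := rfl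

theorem abs_bestErr_le (Θ : Fin 4 → ℝ) (ν : ℕ) (j : Fin 4) :
    |bestErr Θ ν j| ≤ distInt Θ (bestDenom Θ ν) :=
  norm_le_pi_norm (bestErr Θ ν) j

@[simp] theorem bestVec_zero (Θ : Fin 4 → ℝ) (ν : ℕ) : bestVec Θ ν 0 = bestDenom Θ ν := rfl

theorem bestErr_eq (Θ : Fin 4 → ℝ) (ν : ℕ) (j : Fin 4) :
    bestErr Θ ν j = bestVec Θ ν 0 * Θ j - bestVec Θ ν j.succ := rfl

theorem bestVec_eq_intCast (Θ : Fin 4 → ℝ) (ν : ℕ) (j : Fin 5) :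
    ∃ m : ℤ, bestVec Θ ν j = m := by
  refine Fin.cases ⟨bestDenom Θ ν, by simp⟩ (fun i => ⟨_, rfl⟩) j

/-- Leibniz bound for the determinant of a matrix whose entries in row `i` are at most `b i`,
except that in one column they may be larger by a factor `R`. -/
theorem abs_det_le {n : ℕ} (M : Matrix (Fin (n + 1)) (Fin (n + 1)) ℝ) (b : Fin (n + 1) → ℝ)
    {R : ℝ} (h0 : ∀ i, |M i 0| ≤ R * b i) (h : ∀ i (j : Fin n), |M i j.succ| ≤ b i) :
    |M.det| ≤ (n + 1).factorial * (R * ∏ i, b i) := by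
  rw [Matrix.det_apply]
  refine (Finset.abs_sum_le_sum_abs _ _).trans ?_
  have : ∀ σ ∈ (Finset.univ : Finset (Equiv.Perm (Fin (n + 1)))),
      |Equiv.Perm.sign σ • ∏ i, M (σ i) i| ≤ R * ∏ i, b i := by
    intro σ _
    have e : |Equiv.Perm.sign σ • ∏ i, M (σ i) i| = ∏ i, |M (σ i) i| := by
      rw [Units.smul_def, zsmul_eq_mul, abs_mul, Finset.abs_prod]
      rcases Int.units_eq_one_or (Equiv.Perm.sign σ) with h | h <;> simp [h]
    rw [e, ← Equiv.prod_comp σ b, Fin.prod_univ_succ, Fin.prod_univ_succ, ← mul_assoc]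
    refine mul_le_mul (h0 _) (Finset.prod_le_prod (fun _ _ => abs_nonneg _) fun i _ => h _ _)
      (Finset.prod_nonneg fun _ _ => abs_nonneg _) ((abs_nonneg _).trans (h0 _))
  refine (Finset.sum_le_card_nsmul _ _ _ this).trans ?_
  rw [Finset.card_univ, Fintype.card_perm, Fintype.card_fin, nsmul_eq_mul]

/-! ### Areas of planes spanned by consecutive best approximations -/

section Area

variable (hΘ : LinearIndependent ℤ (Fin.cons 1 Θ : Fin 5 → ℝ))
include hΘ

/-- The difference `z_{ν+1} - z_ν` has a positive denominator below `q_{ν+1}`, so it cannot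
approximate better than `z_ν`. -/
theorem distInt_le_norm_bestErr_sub (ν : ℕ) :
    distInt Θ (bestDenom Θ ν) ≤ ‖bestErr Θ (ν + 1) - bestErr Θ ν‖ := by
  have hlt : bestDenom Θ ν < bestDenom Θ (ν + 1) := bestDenom_strictMono hΘ (Nat.lt_succ_self ν)
  have h1 := one_le_bestDenom hΘ ν
  refine (distInt_bestDenom_le hΘ (x := bestDenom Θ (ν + 1) - bestDenom Θ ν) (by omega)
    (by omega)).trans ((distInt_le_norm _ _ fun j => round ((bestDenom Θ (ν + 1) : ℝ) * Θ j) -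
      round ((bestDenom Θ ν : ℝ) * Θ j)).trans (le_of_eq ?_))
  congr 1
  funext j
  rw [Nat.cast_sub hlt.le]
  simp only [bestErr, Pi.sub_apply]
  push_cast
  ring

/-- The parallelogram on two consecutive best approximations has area `≫ L_ν X_{ν+1}`. -/
theorem exists_mul_le_minor (ν : ℕ) : ∃ j : Fin 4,
    distInt Θ (bestDenom Θ ν) * bestDenom Θ (ν + 1) ≤
      2 * |(bestDenom Θ (ν + 1) : ℝ) * bestErr Θ ν j - bestDenom Θ ν * bestErr Θ (ν + 1) j| := by
  set v : Fin 4 → ℝ :=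
    (bestDenom Θ (ν + 1) : ℝ) • bestErr Θ ν - (bestDenom Θ ν : ℝ) • bestErr Θ (ν + 1) with hv
  have hX : (bestDenom Θ ν : ℝ) ≤ bestDenom Θ (ν + 1) := by
    exact_mod_cast (bestDenom_strictMono hΘ).monotone (Nat.le_succ ν)
  have hL := distInt_bestDenom_strictAnti hΘ (Nat.lt_succ_self ν)
  have h1 : (bestDenom Θ (ν + 1) : ℝ) * distInt Θ (bestDenom Θ ν) -
      bestDenom Θ ν * distInt Θ (bestDenom Θ (ν + 1)) ≤ ‖v‖ := by
    refine le_trans (le_of_eq ?_) (norm_sub_norm_le _ _)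
    rw [norm_smul, norm_smul, norm_bestErr, norm_bestErr, Real.norm_natCast, Real.norm_natCast]
  have h2 : (bestDenom Θ (ν + 1) : ℝ) * distInt Θ (bestDenom Θ ν) -
      (bestDenom Θ (ν + 1) - bestDenom Θ ν : ℝ) * distInt Θ (bestDenom Θ (ν + 1)) ≤ ‖v‖ := by
    have e : v = (bestDenom Θ (ν + 1) - bestDenom Θ ν : ℝ) • bestErr Θ (ν + 1) -
        (bestDenom Θ (ν + 1) : ℝ) • (bestErr Θ (ν + 1) - bestErr Θ ν) := by
      rw [hv, smul_sub, sub_smul]; abel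
    rw [e, norm_sub_rev]
    refine le_trans ?_ (norm_sub_norm_le _ _)
    rw [norm_smul, norm_smul, norm_bestErr, Real.norm_natCast, Real.norm_eq_abs,
      abs_of_nonneg (sub_nonneg.2 hX)]
    exact sub_le_sub_right (mul_le_mul_of_nonneg_left (distInt_le_norm_bestErr_sub hΘ ν)
      (Nat.cast_nonneg _)) _
  -- The sum of `h1` and `h2` is `2 X_{ν+1} L_ν - X_{ν+1} L_{ν+1} ≤ 2 ‖v‖`, and `L_{ν+1} < L_ν`.
  have h3 : distInt Θ (bestDenom Θ ν) * bestDenom Θ (ν + 1) ≤ 2 * ‖v‖ := by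
    have := mul_le_mul_of_nonneg_left hL.le (Nat.cast_nonneg (α := ℝ) (bestDenom Θ (ν + 1)))
    simp only at this
    nlinarith
  obtain ⟨j, hj⟩ : ∃ j, ‖v‖ = ‖v j‖ := by
    obtain ⟨j, -, hj⟩ := (Finset.univ : Finset (Fin 4)).exists_max_image (fun j => ‖v j‖) ⟨0, by simp⟩
    exact ⟨j, le_antisymm ((pi_norm_le_iff_of_nonneg (norm_nonneg _)).2 fun i => hj i (by simp))
      (norm_le_pi_norm v j)⟩
  refine ⟨j, h3.trans ?_⟩
  rw [hj]
  rfl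

/-- Two consecutive best approximations form a primitive pair: an integer vector which is a real
combination of them is an integer combination. -/
theorem exists_int_coeff {ν : ℕ}
    (hli : LinearIndependent ℝ ![bestVec Θ ν, bestVec Θ (ν + 1)]) {a b : ℝ}
    (h : ∀ j, ∃ m : ℤ, a * bestVec Θ ν j + b * bestVec Θ (ν + 1) j = m) :
    (∃ m : ℤ, a = m) ∧ ∃ m : ℤ, b = m := by
  -- Removing the nearest integer combination leaves coefficients at most 1/2 in size. The remaining
  -- integer vector has denominator below `q_{ν+1}` and errors below `L_ν`, so it vanishes by
  -- minimality, and independence gives `a' = b' = 0`.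
  set a' := a - round a with ha
  set b' := b - round b with hb
  have ha' : |a'| ≤ 1 / 2 := abs_sub_round a
  have hb' : |b'| ≤ 1 / 2 := abs_sub_round b
  have hm : ∀ j, ∃ m : ℤ, a' * bestVec Θ ν j + b' * bestVec Θ (ν + 1) j = m := fun j => by
    obtain ⟨m, hm⟩ := h j
    obtain ⟨s, hs⟩ := bestVec_eq_intCast Θ ν j
    obtain ⟨t, ht⟩ := bestVec_eq_intCast Θ (ν + 1) j
    refine ⟨m - round a * s - round b * t, ?_⟩
    rw [hs, ht] at hm ⊢
    push_cast
    rw [← hm]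
    ring
  choose m hm using hm
  have hX : (bestDenom Θ ν : ℝ) < bestDenom Θ (ν + 1) := by
    exact_mod_cast bestDenom_strictMono hΘ (Nat.lt_succ_self ν)
  have hX0 : (1 : ℝ) ≤ bestDenom Θ ν := by exact_mod_cast one_le_bestDenom hΘ ν
  have hL := distInt_bestDenom_strictAnti hΘ (Nat.lt_succ_self ν)
  simp only at hL
  have hL0 := distInt_bestDenom_pos hΘ (ν + 1)
  have hq : |(m 0 : ℝ)| < bestDenom Θ (ν + 1) := by
    rw [← hm 0]
    refine (abs_add_le _ _).trans_lt ?_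
    rw [abs_mul, abs_mul, bestVec_zero, bestVec_zero, Nat.abs_cast, Nat.abs_cast]
    nlinarith
  have herr : ∀ j : Fin 4, |(m 0 : ℝ) * Θ j - m j.succ| < distInt Θ (bestDenom Θ ν) := fun j => by
    have e : (m 0 : ℝ) * Θ j - m j.succ = a' * bestErr Θ ν j + b' * bestErr Θ (ν + 1) j := by
      rw [bestErr_eq, bestErr_eq, ← hm 0, ← hm j.succ]
      ring
    rw [e]
    refine (abs_add_le _ _).trans_lt ?_
    rw [abs_mul, abs_mul]
    have h1 := mul_le_mul ha' (abs_bestErr_le Θ ν j) (abs_nonneg _) (by norm_num)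
    have h2 := mul_le_mul hb' (abs_bestErr_le Θ (ν + 1) j) (abs_nonneg _) (by norm_num)
    linarith
  have hm0 : m 0 = 0 := by
    by_contra hne
    have hx : 1 ≤ (m 0).natAbs := Int.natAbs_pos.2 hne
    have hlt : (m 0).natAbs < bestDenom Θ (ν + 1) := by
      have : (((m 0).natAbs : ℕ) : ℝ) < bestDenom Θ (ν + 1) := by
        rwa [Nat.cast_natAbs, Int.cast_abs]
      exact_mod_cast this
    have h1 := (distInt_bestDenom_le hΘ hx hlt).trans
      (distInt_le_norm Θ _ fun j => (m 0).sign * m j.succ)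
    refine absurd h1 (not_le.2 ((pi_norm_lt_iff (hL0.trans hL)).2 fun j => ?_))
    refine lt_of_eq_of_lt ?_ (herr j)
    have hs : (((m 0).natAbs : ℕ) : ℝ) = (m 0).sign * m 0 := by
      rw [Nat.cast_natAbs, ← Int.sign_mul_self_eq_abs]
      push_cast; ring
    rw [hs, Real.norm_eq_abs]
    push_cast
    rw [mul_assoc, ← mul_sub, abs_mul]
    have : |((m 0).sign : ℝ)| = 1 := by
      rw [← Int.cast_abs, Int.abs_sign_of_ne_zero hne]; simp
    rw [this, one_mul]
  -- With zero denominator the errors are, up to sign, the integers `m j` themselves, and they are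
  -- below 1/2.
  have hmj : ∀ j, m j = 0 := by
    refine Fin.cases hm0 fun j => ?_
    have h1 := (herr j).trans_le (distInt_le_half Θ _)
    rw [hm0, Int.cast_zero, zero_mul, zero_sub, abs_neg] at h1
    by_contra hne
    have : (1 : ℝ) ≤ |(m j.succ : ℝ)| := by exact_mod_cast Int.one_le_abs hne
    linarith
  have hz := LinearIndependent.pair_iff.1 hli a' b' (by
    funext j
    simpa [hmj j] using hm j)
  exact ⟨⟨round a, by linarith [hz.1]⟩, ⟨round b, by linarith [hz.2]⟩⟩

/-- If `z_r, z_{r+1}, z_{s}, z_{s+1}` lie in one plane, then `L_s X_{s+1} ≪ L_r X_{r+1}`. -/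
theorem mul_le_of_coplanar {r s : ℕ}
    (hr : LinearIndependent ℝ ![bestVec Θ r, bestVec Θ (r + 1)])
    (hs : LinearIndependent ℝ ![bestVec Θ s, bestVec Θ (s + 1)])
    (h0 : bestVec Θ r ∈ Submodule.span ℝ {bestVec Θ s, bestVec Θ (s + 1)})
    (h1 : bestVec Θ (r + 1) ∈ Submodule.span ℝ {bestVec Θ s, bestVec Θ (s + 1)}) :
    distInt Θ (bestDenom Θ s) * bestDenom Θ (s + 1) ≤
      4 * (distInt Θ (bestDenom Θ r) * bestDenom Θ (r + 1)) := by
  obtain ⟨a, b, hab⟩ := Submodule.mem_span_pair.1 h0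
  obtain ⟨c, d, hcd⟩ := Submodule.mem_span_pair.1 h1
  have eab : ∀ j, a * bestVec Θ s j + b * bestVec Θ (s + 1) j = bestVec Θ r j := fun j =>
    congrFun hab j
  have ecd : ∀ j, c * bestVec Θ s j + d * bestVec Θ (s + 1) j = bestVec Θ (r + 1) j := fun j =>
    congrFun hcd j
  obtain ⟨⟨a', rfl⟩, ⟨b', rfl⟩⟩ := exists_int_coeff hΘ hs (a := a) (b := b) fun j => by
    rw [eab]; exact bestVec_eq_intCast _ _ _
  obtain ⟨⟨c', rfl⟩, ⟨d', rfl⟩⟩ := exists_int_coeff hΘ hs (a := c) (b := d) fun j => by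
    rw [ecd]; exact bestVec_eq_intCast _ _ _
  -- The minors of the two pairs differ by this determinant, an integer which is nonzero because
  -- `z_r, z_{r+1}` are independent.
  have hdet : a' * d' - b' * c' ≠ 0 := by
    intro hdet
    have hdet' : (a' : ℝ) * d' - b' * c' = 0 := by exact_mod_cast hdet
    have k1 := LinearIndependent.pair_iff.1 hr d' (-b') (by
      rw [← hab, ← hcd]
      funext j
      simp only [Pi.add_apply, Pi.smul_apply, smul_eq_mul, Pi.zero_apply]
      linear_combination bestVec Θ s j * hdet')
    have k2 := LinearIndependent.pair_iff.1 hr (-c') a' (by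
      rw [← hab, ← hcd]
      funext j
      simp only [Pi.add_apply, Pi.smul_apply, smul_eq_mul, Pi.zero_apply]
      linear_combination bestVec Θ (s + 1) j * hdet')
    have := hr.ne_zero 0
    simp only [Matrix.cons_val_zero] at this
    rw [← hab, k2.2, neg_eq_zero.1 k1.2] at this
    simp at this
  have hdet1 : (1 : ℝ) ≤ |(a' : ℝ) * d' - b' * c'| := by exact_mod_cast Int.one_le_abs hdet
  obtain ⟨j, hj⟩ := exists_mul_le_minor hΘ s
  have e : (bestDenom Θ (r + 1) : ℝ) * bestErr Θ r j - bestDenom Θ r * bestErr Θ (r + 1) j =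
      ((a' : ℝ) * d' - b' * c') *
        ((bestDenom Θ (s + 1) : ℝ) * bestErr Θ s j - bestDenom Θ s * bestErr Θ (s + 1) j) := by
    simp only [bestErr_eq, ← bestVec_zero]
    rw [← eab 0, ← ecd 0, ← eab j.succ, ← ecd j.succ]
    ring
  have hX : (bestDenom Θ r : ℝ) ≤ bestDenom Θ (r + 1) := by
    exact_mod_cast (bestDenom_strictMono hΘ).monotone (Nat.le_succ r)
  have hL := (distInt_bestDenom_strictAnti hΘ (Nat.lt_succ_self r)).le
  simp only at hL
  have hup : |(bestDenom Θ (r + 1) : ℝ) * bestErr Θ r j - bestDenom Θ r * bestErr Θ (r + 1) j| ≤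
      2 * (distInt Θ (bestDenom Θ r) * bestDenom Θ (r + 1)) := by
    refine (abs_sub _ _).trans ?_
    rw [abs_mul, abs_mul, Nat.abs_cast, Nat.abs_cast]
    have h1 := mul_le_mul_of_nonneg_left (abs_bestErr_le Θ r j)
      (Nat.cast_nonneg (α := ℝ) (bestDenom Θ (r + 1)))
    have h2 := mul_le_mul hX ((abs_bestErr_le Θ (r + 1) j).trans hL) (abs_nonneg _)
      (Nat.cast_nonneg _)
    linarith
  rw [e, abs_mul] at hup
  have := le_mul_of_one_le_left
    (abs_nonneg ((bestDenom Θ (s + 1) : ℝ) * bestErr Θ s j - bestDenom Θ s * bestErr Θ (s + 1) j))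
    hdet1
  linarith

end Area

/-! ### The five-dimensional volume estimate -/

theorem one_le_abs_det {n : ℕ} {v : Fin n → Fin n → ℝ} (hv : LinearIndependent ℝ v)
    (h : ∀ i j, ∃ m : ℤ, v i j = m) : 1 ≤ |(Matrix.of v).det| := by
  choose m hm using h
  have e : Matrix.of v = (Matrix.of m).map (Int.castRingHom ℝ) := by
    ext i j
    simpa using hm i j
  have hu := (Matrix.isUnit_iff_isUnit_det _).1
    ((Matrix.linearIndependent_rows_iff_isUnit (A := Matrix.of v)).1 hv)
  have hne := hu.ne_zero
  rw [e, ← RingHom.mapMatrix_apply, ← RingHom.map_det] at hne ⊢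
  have : (Matrix.of m).det ≠ 0 := fun h0 => hne (by rw [h0, map_zero])
  simpa using (by exact_mod_cast Int.one_le_abs this : (1 : ℝ) ≤ |((Matrix.of m).det : ℝ)|)

/-- The change of coordinates `(x_0, x_j) ↦ (x_0, x_0 θ_j - x_j)` on rows. -/
noncomputable def errTransform (Θ : Fin 4 → ℝ) : Matrix (Fin 5) (Fin 5) ℝ :=
  Matrix.of (Fin.cons (Fin.cons 1 Θ) fun i => Fin.cons 0 fun j => if i = j then -1 else 0)

theorem det_errTransform (Θ : Fin 4 → ℝ) : (errTransform Θ).det = 1 := by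
  rw [Matrix.det_of_isUpperTriangular]
  · norm_num [errTransform, Fin.prod_univ_succ]
  · intro i j hij
    induction i using Fin.cases with
    | zero => exact absurd hij (Fin.not_lt_zero j)
    | succ i =>
      induction j using Fin.cases with
      | zero => simp [errTransform]
      | succ j =>
        have : i ≠ j := fun h => by simp [h] at hij
        simp [errTransform, this]

theorem mul_errTransform_zero (Z : Matrix (Fin 5) (Fin 5) ℝ) (i : Fin 5) :
    (Z * errTransform Θ) i 0 = Z i 0 := by
  simp [Matrix.mul_apply, errTransform, Fin.sum_univ_succ (n := 4)]

theorem mul_errTransform_succ (Z : Matrix (Fin 5) (Fin 5) ℝ) (i : Fin 5) (j : Fin 4) :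
    (Z * errTransform Θ) i j.succ = Z i 0 * Θ j - Z i j.succ := by
  simp [Matrix.mul_apply, errTransform, Fin.sum_univ_succ (n := 4), sub_eq_add_neg]

/-- Adding combinations of the three middle rows to the first and the last one. -/
theorem det_add_middle_rows (p t₁ t₂ t₃ e : Fin 5 → ℝ) (c d : Fin 3 → ℝ) :
    (Matrix.of ![p + (c 0 • t₁ + c 1 • t₂ + c 2 • t₃), t₁, t₂, t₃,
      e + (d 0 • t₁ + d 1 • t₂ + d 2 • t₃)]).det = (Matrix.of ![p, t₁, t₂, t₃, e]).det := by
  have h : Matrix.of ![p + (c 0 • t₁ + c 1 • t₂ + c 2 • t₃), t₁, t₂, t₃,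
      e + (d 0 • t₁ + d 1 • t₂ + d 2 • t₃)] =
      !![1, c 0, c 1, c 2, 0; 0, 1, 0, 0, 0; 0, 0, 1, 0, 0; 0, 0, 0, 1, 0;
        0, d 0, d 1, d 2, 1] * Matrix.of ![p, t₁, t₂, t₃, e] := by
    ext i j
    fin_cases i <;> simp [Matrix.mul_apply, Fin.sum_univ_succ] <;> ring
  rw [h, Matrix.det_mul]
  simp [Matrix.det_succ_column_zero, Fin.sum_univ_succ]

/-- Replacing the middle vectors of a basis of `ℝ⁵` by others whose span contains them. -/
theorem linearIndependent_replace {p b c d e t₁ t₂ t₃ : Fin 5 → ℝ}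
    (h : LinearIndependent ℝ ![p, b, c, d, e])
    (hb : b ∈ Submodule.span ℝ {t₁, t₂, t₃}) (hc : c ∈ Submodule.span ℝ {t₁, t₂, t₃})
    (hd : d ∈ Submodule.span ℝ {t₁, t₂, t₃}) : LinearIndependent ℝ ![p, t₁, t₂, t₃, e] := by
  refine linearIndependent_of_top_le_span_of_card_eq_finrank ?_ (by simp)
  rw [← h.span_eq_top_of_card_eq_finrank (by simp), Submodule.span_le]
  have hle : Submodule.span ℝ {t₁, t₂, t₃} ≤
      Submodule.span ℝ (Set.range ![p, t₁, t₂, t₃, e]) := by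
    refine Submodule.span_mono ?_
    rintro x (rfl | rfl | rfl)
    exacts [⟨1, rfl⟩, ⟨2, rfl⟩, ⟨3, rfl⟩]
  rintro x ⟨i, rfl⟩
  fin_cases i
  exacts [Submodule.subset_span ⟨0, rfl⟩, hle hb, hle hc, hle hd, Submodule.subset_span ⟨4, rfl⟩]

/-- The volume estimate: if `z_p`, the triple at `a` and `z_{k+1}` form a basis and `z_k` lies in
the space of the triple, then `L_p L_{a-1} L_a X_{a+1} L_k X_{k+1} / X_k ≫ 1`. -/
theorem bestDenom_le_volume (hΘ : LinearIndependent ℤ (Fin.cons 1 Θ : Fin 5 → ℝ)) {p a k : ℕ}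
    (hpk : p ≤ k)
    (hli : LinearIndependent ℝ ![bestVec Θ p, bestVec Θ a, bestVec Θ (a + 1), bestVec Θ (a + 2),
      bestVec Θ (k + 1)])
    (hk : bestVec Θ k ∈
      Submodule.span ℝ {bestVec Θ a, bestVec Θ (a + 1), bestVec Θ (a + 2)}) :
    (bestDenom Θ k : ℝ) ≤ 480 * (distInt Θ (bestDenom Θ p) * distInt Θ (bestDenom Θ a) *
      distInt Θ (bestDenom Θ (a + 1)) * bestDenom Θ (a + 2) * distInt Θ (bestDenom Θ k) *
      bestDenom Θ (k + 1)) := by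
  have hX : ∀ i, (0 : ℝ) < bestDenom Θ i := fun i => by exact_mod_cast one_le_bestDenom hΘ i
  have hXm : ∀ {i j}, i ≤ j → (bestDenom Θ i : ℝ) ≤ bestDenom Θ j := fun h => by
    exact_mod_cast (bestDenom_strictMono hΘ).monotone h
  have hL : ∀ i, 0 < distInt Θ (bestDenom Θ i) := distInt_bestDenom_pos hΘ
  have hLm : ∀ {i j}, i ≤ j → distInt Θ (bestDenom Θ j) ≤ distInt Θ (bestDenom Θ i) :=
    fun h => (distInt_bestDenom_strictAnti hΘ).antitone h
  obtain ⟨x, y, z, hxyz⟩ := Submodule.mem_span_triple.1 hk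
  have hdet : 1 ≤ |(Matrix.of ![bestVec Θ p, bestVec Θ a, bestVec Θ (a + 1), bestVec Θ (a + 2),
      bestVec Θ (k + 1)]).det| := by
    refine one_le_abs_det hli fun i j => ?_
    fin_cases i <;> exact bestVec_eq_intCast _ _ _
  -- These multiples of `z_k`, a combination of the middle rows, cancel the first coordinates of the
  -- outer rows without changing the determinant.
  set cp : ℝ := bestDenom Θ p / bestDenom Θ k with hcp
  set ce : ℝ := bestDenom Θ (k + 1) / bestDenom Θ k with hce
  have hcp0 : 0 ≤ cp := (div_pos (hX _) (hX _)).le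
  have hce0 : 0 ≤ ce := (div_pos (hX _) (hX _)).le
  have hcp1 : cp ≤ 1 := (div_le_one (hX _)).2 (hXm hpk)
  have hce1 : 1 ≤ ce := (one_le_div (hX _)).2 (hXm (Nat.le_succ _))
  rw [← det_add_middle_rows _ _ _ _ _ ![-cp * x, -cp * y, -cp * z] ![-ce * x, -ce * y, -ce * z]]
    at hdet
  have comb : ∀ s : ℝ, (-s * x) • bestVec Θ a + (-s * y) • bestVec Θ (a + 1) +
      (-s * z) • bestVec Θ (a + 2) = -s • bestVec Θ k := fun s => by
    rw [← hxyz]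
    module
  simp only [Matrix.cons_val_zero, Matrix.cons_val_one, Matrix.cons_val, comb] at hdet
  set Z := Matrix.of ![bestVec Θ p + -cp • bestVec Θ k, bestVec Θ a, bestVec Θ (a + 1),
    bestVec Θ (a + 2), bestVec Θ (k + 1) + -ce • bestVec Θ k] with hZ
  rw [← mul_one Z.det, ← det_errTransform Θ, ← Matrix.det_mul, det_errTransform] at hdet
  -- As `X` increases and `L` decreases, `X_i ≤ R L_i` for all three middle rows. In the Leibniz
  -- bound, `R` then turns the factor `L_{a+2}` into `X_{a+2}`.
  set R : ℝ := bestDenom Θ (a + 2) / distInt Θ (bestDenom Θ (a + 2)) with hR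
  have hR0 : 0 ≤ R := (div_pos (hX _) (hL _)).le
  have hRa : (bestDenom Θ (a + 2) : ℝ) = R * distInt Θ (bestDenom Θ (a + 2)) :=
    (div_mul_cancel₀ _ (hL _).ne').symm
  have hRi : ∀ i ≤ a + 2, (bestDenom Θ i : ℝ) ≤ R * distInt Θ (bestDenom Θ i) := fun i hi =>
    (hXm hi).trans (hRa.le.trans (mul_le_mul_of_nonneg_left (hLm hi) hR0))
  set b : Fin 5 → ℝ := ![2 * distInt Θ (bestDenom Θ p), distInt Θ (bestDenom Θ a),
    distInt Θ (bestDenom Θ (a + 1)), distInt Θ (bestDenom Θ (a + 2)),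
    2 * (ce * distInt Θ (bestDenom Θ k))] with hb
  have hbound := abs_det_le (Z * errTransform Θ) b (R := R) (fun i => by
      rw [mul_errTransform_zero]
      fin_cases i
      · have : (bestDenom Θ p : ℝ) + -cp * bestDenom Θ k = 0 := by
          rw [hcp, neg_mul, div_mul_cancel₀ _ (hX k).ne', add_neg_cancel]
        have h0 := mul_nonneg hR0 (mul_nonneg zero_le_two (hL p).le)
        simpa [hZ, hb, ← neg_mul, this] using h0
      · simpa [hZ, hb] using hRi a (by omega)
      · simpa [hZ, hb] using hRi (a + 1) (by omega)
      · simpa [hZ, hb] using hRi (a + 2) (by omega)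
      · have : (bestDenom Θ (k + 1) : ℝ) + -ce * bestDenom Θ k = 0 := by
          rw [hce, neg_mul, div_mul_cancel₀ _ (hX k).ne', add_neg_cancel]
        have h0 := mul_nonneg hR0 (mul_nonneg zero_le_two (mul_nonneg hce0 (hL k).le))
        simpa [hZ, hb, ← neg_mul, this] using h0)
    (fun i j => by
      rw [mul_errTransform_succ]
      fin_cases i
      · have e : (bestVec Θ p + -cp • bestVec Θ k) 0 * Θ j -
            (bestVec Θ p + -cp • bestVec Θ k) j.succ = bestErr Θ p j - cp * bestErr Θ k j := by
          simp only [bestErr_eq, Pi.add_apply, Pi.smul_apply, smul_eq_mul]; ring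
        change |(bestVec Θ p + -cp • bestVec Θ k) 0 * Θ j -
            (bestVec Θ p + -cp • bestVec Θ k) j.succ| ≤ 2 * distInt Θ (bestDenom Θ p)
        rw [e]
        refine (abs_sub _ _).trans ?_
        rw [abs_mul, abs_of_nonneg hcp0]
        have h1 := abs_bestErr_le Θ p j
        have h2 := mul_le_mul hcp1 ((abs_bestErr_le Θ k j).trans (hLm hpk)) (abs_nonneg _)
          zero_le_one
        linarith
      · exact abs_bestErr_le Θ a j
      · exact abs_bestErr_le Θ (a + 1) j
      · exact abs_bestErr_le Θ (a + 2) j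
      · have e : (bestVec Θ (k + 1) + -ce • bestVec Θ k) 0 * Θ j -
            (bestVec Θ (k + 1) + -ce • bestVec Θ k) j.succ =
            bestErr Θ (k + 1) j - ce * bestErr Θ k j := by
          simp only [bestErr_eq, Pi.add_apply, Pi.smul_apply, smul_eq_mul]; ring
        change |(bestVec Θ (k + 1) + -ce • bestVec Θ k) 0 * Θ j -
            (bestVec Θ (k + 1) + -ce • bestVec Θ k) j.succ| ≤
              2 * (ce * distInt Θ (bestDenom Θ k))
        rw [e]
        refine (abs_sub _ _).trans ?_
        rw [abs_mul, abs_of_nonneg hce0]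
        have h1 := (abs_bestErr_le Θ (k + 1) j).trans (hLm (Nat.le_succ k))
        have h2 := mul_le_mul_of_nonneg_left (abs_bestErr_le Θ k j) hce0
        have h3 := le_mul_of_one_le_left (hL k).le hce1
        linarith)
  have hfin := hdet.trans hbound
  have e : R * ∏ i, b i = 4 * (distInt Θ (bestDenom Θ p) * distInt Θ (bestDenom Θ a) *
      distInt Θ (bestDenom Θ (a + 1)) * bestDenom Θ (a + 2) * distInt Θ (bestDenom Θ k) * ce) := by
    rw [hRa]
    simp [hb, Fin.prod_univ_succ]
    ring
  rw [e, hce, mul_div_assoc', mul_div_assoc', mul_div_assoc', le_div_iff₀ (hX k), one_mul] at hfin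
  refine hfin.trans (le_of_eq ?_)
  -- 480 is `5!` times the two factors 2 from the outer rows.
  norm_num [Nat.factorial]
  ring

/-! ### Estimates from a configuration -/

theorem linearIndependent_pairs {u v w : Fin 5 → ℝ} (h : LinearIndependent ℝ ![u, v, w]) :
    LinearIndependent ℝ ![u, v] ∧ LinearIndependent ℝ ![v, w] := by
  constructor
  · convert h.comp ![0, 1] (by decide) using 1
    funext i
    fin_cases i <;> rfl
  · convert h.comp ![1, 2] (by decide) using 1
    funext i
    fin_cases i <;> rfl

theorem span_pair_eq {u v : Fin 5 → ℝ} {P : Submodule ℝ (Fin 5 → ℝ)} (hP : Module.finrank ℝ P = 2)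
    (h : LinearIndependent ℝ ![u, v]) (hu : u ∈ P) (hv : v ∈ P) : Submodule.span ℝ {u, v} = P := by
  refine Submodule.eq_of_le_of_finrank_eq ?_ ?_
  · rw [Submodule.span_le]
    rintro x (rfl | rfl)
    exacts [hu, hv]
  · have := finrank_span_eq_card h
    rw [Matrix.range_cons, Matrix.range_cons, Matrix.range_empty, Set.union_empty,
      Set.singleton_union] at this
    rw [this, hP]
    rfl

namespace IsConfiguration

variable {n : ℕ} {r : ℕ → ℕ}

/-- The common space `T` contains `z_{r_n - 1}` and the plane of `z_{r_n}, z_{r_n + 1}`, which holds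
everything up to `z_k`. For `n ≥ 1`, the triple at `r_1` also spans `T`. -/
theorem bestVec_mem_span_triple (h : IsConfiguration Θ n r) (hn : 1 ≤ n) {j : ℕ}
    (hj1 : r n - 1 ≤ j) (hj2 : j ≤ r (n + 1)) : bestVec Θ j ∈
      Submodule.span ℝ {bestVec Θ (r 1 - 1), bestVec Θ (r 1), bestVec Θ (r 1 + 1)} := by
  obtain ⟨T, -, hT, -, -⟩ := h.space
  rw [hT 1 le_rfl hn, ← hT n hn le_rfl]
  rcases hj1.eq_or_lt with rfl | hj1
  · exact Submodule.subset_span (by simp)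
  · obtain ⟨P, hP, hPj⟩ := h.planes n le_rfl
    have hlt := h.lt_succ n le_rfl
    have hmem := hPj j (by omega) hj2
    rw [← span_pair_eq hP (linearIndependent_pairs (h.triple_indep n (by omega))).2
      (hPj _ le_rfl hlt.le) (hPj _ (Nat.le_succ _) hlt)] at hmem
    refine Submodule.span_mono ?_ hmem
    exact Set.subset_insert _ _

theorem lt_of_lt (h : IsConfiguration Θ n r) {i j : ℕ} (hij : i < j) (hj : j ≤ n + 1) :
    r i < r j := by
  induction j, hij using Nat.le_induction with
  | base => exact h.lt_succ i (by omega)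
  | succ j hij ih => exact (ih (by omega)).trans (h.lt_succ j (by omega))

/-- The two estimates on best approximations given by a configuration of length at least one. -/
theorem exists_estimates (hΘ : LinearIndependent ℤ (Fin.cons 1 Θ : Fin 5 → ℝ))
    (h : IsConfiguration Θ n r) (hn : 1 ≤ n) : ∃ p a k : ℕ, r 0 = p + 1 ∧ p + 1 ≤ a ∧ a + 2 ≤ k ∧
      (bestDenom Θ k : ℝ) ≤ 480 * (distInt Θ (bestDenom Θ p) * distInt Θ (bestDenom Θ a) *
        distInt Θ (bestDenom Θ (a + 1)) * bestDenom Θ (a + 2) * distInt Θ (bestDenom Θ k) *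
        bestDenom Θ (k + 1)) ∧
      distInt Θ (bestDenom Θ a) * bestDenom Θ (a + 1) ≤
        4 * (distInt Θ (bestDenom Θ (p + 1)) * bestDenom Θ (p + 2)) := by
  have h01 := h.lt_of_lt one_pos (by omega)
  have h1k : r 1 < r (n + 1) := h.lt_of_lt (Nat.lt_succ_of_le hn) le_rfl
  have hnk := h.lt_succ n le_rfl
  have hr0 := h.one_le
  obtain ⟨p, hp⟩ : ∃ p, r 0 = p + 1 := ⟨r 0 - 1, by omega⟩
  obtain ⟨a, ha⟩ : ∃ a, r 1 = a + 1 := ⟨r 1 - 1, by omega⟩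
  have hmem := fun {j} => h.bestVec_mem_span_triple hn (j := j)
  have h5 := h.five_indep
  have ht0 := h.triple_indep 0 (by omega)
  have ht1 := h.triple_indep 1 (by omega)
  obtain ⟨P, hP, hPj⟩ := h.planes 0 (by omega)
  simp only [ha, hp, zero_add, Nat.add_sub_cancel] at hmem h5 ht0 ht1 hPj
  refine ⟨p, a, r (n + 1), hp, by omega, by omega, ?_, ?_⟩
  · exact bestDenom_le_volume hΘ (by omega)
      (linearIndependent_replace h5 (hmem le_rfl (by omega)) (hmem (by omega) (by omega))
        (hmem (by omega) le_rfl))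
      (hmem (by omega) le_rfl)
  · have hli := (linearIndependent_pairs ht1).1
    have hspan := span_pair_eq hP hli (hPj _ (by omega) (by omega)) (hPj _ (by omega) (by omega))
    refine mul_le_of_coplanar hΘ (linearIndependent_pairs ht0).2 hli ?_ ?_ <;> rw [hspan]
    · exact hPj _ le_rfl (by omega)
    · exact hPj _ (by omega) (by omega)

end IsConfiguration

/-! ### Linear programming in logarithmic sizes -/

/-- The linear-programming step: logarithmic sizes of best approximations in a configuration force
`f₁(g) ≥ 0` up to a bounded error. -/
theorem f₁_nonneg_of_estimates {α g K : ℝ} (hα : 0 < α) (hα1 : α < 1) (hg : 0 < g) (hK : 0 ≤ K)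
    (h : ∀ B : ℝ, ∃ p s u v y₀ y₁ xa xa' xk xk' lk : ℝ, B ≤ p ∧
      p ≤ s ∧ s ≤ u ∧ u ≤ v ∧ xa' ≤ xk ∧
      α * y₀ ≤ p ∧ α * y₁ ≤ s ∧ α * xa' ≤ v ∧ α * xk' ≤ lk ∧
      s ≤ α * g * y₀ ∧ v ≤ α * g * xa ∧ lk ≤ α * g * xk ∧
      xk + p + u + v + lk ≤ xa' + xk' + K ∧ xa + s ≤ y₁ + u + K) :
    0 ≤ f₁ α g := by
  have hα' : 0 < 1 - α := by linarith
  have hf : f₁ α g = (g ^ 3 * (1 - α) - α * (g ^ 2 + g + 1)) / (1 - α) := by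
    unfold f₁
    field_simp
    ring
  rw [hf]
  refine div_nonneg ?_ hα'.le
  by_cases hgl : 1 < (1 - α) * g
  · have h1 : g < (1 - α) * g ^ 2 := by nlinarith
    have h2 : g ^ 2 < (1 - α) * g ^ 3 := by nlinarith [mul_pos hg hg]
    nlinarith
  rw [not_lt] at hgl
  set e : ℝ := ((1 - α) * g - α) / α with he
  have hea : e * α = (1 - α) * g - α := div_mul_cancel₀ _ hα.ne'
  have step : ∀ {p u v xa' xk xk' lk : ℝ}, xa' ≤ xk → α * xa' ≤ v → α * xk' ≤ lk →
      lk ≤ α * g * xk → xk + p + u + v + lk ≤ xa' + xk' + K → p + u - K ≤ e * v := by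
    intro p u v xa' xk xk' lk h1 h2 h3 h4 h5
    have i1 : α * (xk' - lk) ≤ α * ((1 - α) * g * xk) := by nlinarith
    have i2 : xk' - lk ≤ (1 - α) * g * xk := le_of_mul_le_mul_left i1 hα
    have i3 : p + u + v - K ≤ (1 - α) * g * xa' := by nlinarith
    have i4 : α * (p + u + v - K) ≤ (1 - α) * g * v := by
      have := mul_le_mul_of_nonneg_left h2 (mul_nonneg hα'.le hg.le)
      nlinarith
    have i5 : α * (p + u - K) ≤ α * (e * v) := by
      rw [show α * (e * v) = e * α * v by ring, hea]
      linarith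
    exact le_of_mul_le_mul_left i5 hα
  have step' : ∀ {s u v y₁ xa : ℝ}, 0 < e → α * y₁ ≤ s → v ≤ α * g * xa → xa + s ≤ y₁ + u + K →
      e * v ≤ e * g * (1 - α) * s + e * α * g * (u + K) := by
    intro s u v y₁ xa h1 h2 h3 h4
    have i1 : α * xa ≤ (1 - α) * s + α * (u + K) := by nlinarith
    have i2 : v ≤ g * ((1 - α) * s + α * (u + K)) := by nlinarith
    nlinarith [mul_le_mul_of_nonneg_left i2 h1.le]
  have he0 : 0 < e := by
    obtain ⟨p, s, u, v, y₀, y₁, xa, xa', xk, xk', lk, hB, h1, h2, h3, h4, h5, h6, h7, h8, h9,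
      h10, h11, h12, h13⟩ := h (K + 1)
    have := step h4 h7 h8 h11 h12
    exact pos_of_mul_pos_left (a := e) (b := v) (by linarith) (by linarith)
  -- Again one case is immediate. In the other, `1 - e * α * g ≥ 0` lets `u` be replaced by the
  -- smaller `s` when `step` and `step'` are combined.
  by_cases hcase : 1 < e * α * g
  · rw [hea] at hcase
    have h1 : 0 < (1 - α) * g - α := pos_of_mul_pos_left (by linarith) hg.le
    nlinarith
  rw [not_lt] at hcase
  by_contra! hneg
  -- Times `α`, this is `-(1 - α) * f₁ α g`, so it is positive exactly under the contrary
  -- assumption; it is the final coefficient of `s`.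
  have hc : 0 < 1 - g * (e * g - 1) := by
    refine pos_of_mul_pos_right (a := α) ?_ hα.le
    have : α * (1 - g * (e * g - 1)) = α + α * g - (e * α) * g ^ 2 := by ring
    rw [this, hea]
    nlinarith
  -- The lower bound for `p` exceeds by 1 the upper bound for `s` reached in `i5`, contradicting `p
  -- ≤ s`.
  obtain ⟨p, s, u, v, y₀, y₁, xa, xa', xk, xk', lk, hB, h1, h2, h3, h4, h5, h6, h7, h8, h9,
    h10, h11, h12, h13⟩ := h (g * K * (1 + e * α * g) / (1 - g * (e * g - 1)) + 1)
  have i1 := step h4 h7 h8 h11 h12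
  have i2 := step' he0 h6 h10 h13
  have i3 : p ≤ K * (1 + e * α * g) + (e * g - 1) * s := by
    nlinarith [mul_le_mul_of_nonneg_left h2 (sub_nonneg.2 hcase)]
  have i4 : s ≤ g * p := by nlinarith
  have i5 : s * (1 - g * (e * g - 1)) ≤ g * K * (1 + e * α * g) := by
    nlinarith [mul_le_mul_of_nonneg_left i3 hg.le]
  rw [← le_div_iff₀ hc] at i5
  linarith

/-- The main estimate: exponents `α < ω̂` and `α g > ω` satisfy `f₁(g) ≥ 0`. -/
theorem f₁_nonneg (hΘ : LinearIndependent ℤ (Fin.cons 1 Θ : Fin 5 → ℝ)) {n : ℕ} (hn : 1 ≤ n)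
    (hconf : HasConfigurations Θ n) {α g : ℝ} (hα : 0 < α) (hα1 : α < 1) (hg : 0 < g)
    (hlow : (α : EReal) < uniformExponent Θ)
    (hup : ordinaryExponent Θ < ((α * g : ℝ) : EReal)) : 0 ≤ f₁ α g := by
  obtain ⟨r, hr, hconf⟩ := hconf
  obtain ⟨N₁, hN₁⟩ := eventually_atTop.1 (eventually_mul_log_le hΘ hlow)
  obtain ⟨N₂, hN₂⟩ := eventually_atTop.1 (eventually_le_mul_log hΘ hup)
  have hlim : Tendsto (fun ν => -Real.log (distInt Θ (bestDenom Θ ν))) atTop atTop := by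
    have hq : Tendsto (fun ν => (bestDenom Θ (ν + 1) : ℝ)) atTop atTop :=
      tendsto_natCast_atTop_atTop.comp
        ((bestDenom_strictMono hΘ).tendsto_atTop.comp (tendsto_add_atTop_nat 1))
    exact tendsto_atTop_mono' _ (eventually_mul_log_le hΘ hlow)
      ((Real.tendsto_log_atTop.comp hq).const_mul_atTop hα)
  have hX : ∀ i, (0 : ℝ) < bestDenom Θ i := fun i => by exact_mod_cast one_le_bestDenom hΘ i
  have hL : ∀ i, 0 < distInt Θ (bestDenom Θ i) := distInt_bestDenom_pos hΘ
  have hXm : ∀ {i j}, i ≤ j → Real.log (bestDenom Θ i) ≤ Real.log (bestDenom Θ j) := fun h =>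
    Real.log_le_log (hX _) (by exact_mod_cast (bestDenom_strictMono hΘ).monotone h)
  have hLm : ∀ {i j}, i ≤ j →
      -Real.log (distInt Θ (bestDenom Θ i)) ≤ -Real.log (distInt Θ (bestDenom Θ j)) := fun h =>
    neg_le_neg (Real.log_le_log (hL _) ((distInt_bestDenom_strictAnti hΘ).antitone h))
  refine f₁_nonneg_of_estimates (K := Real.log 480) hα hα1 hg (Real.log_nonneg (by norm_num))
    fun B => ?_
  obtain ⟨N₃, hN₃⟩ := eventually_atTop.1 (hlim.eventually_ge_atTop B)
  obtain ⟨l, hl⟩ := (hr.eventually_ge_atTop (max N₁ (max N₂ N₃) + 1)).exists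
  obtain ⟨p, a, k, hp, hpa, hak, hvol, harea⟩ := (hconf l).exists_estimates hΘ hn
  rw [hp] at hl
  have hp1 : N₁ ≤ p := by omega
  have hp2 : N₂ ≤ p := by omega
  have hp3 : N₃ ≤ p := by omega
  -- Here `p, s, u, v, lk` become `-log L` at `p, p+1, a, a+1, k`, and `y₀, y₁, xa, xa', xk, xk'`
  -- become `log X` at `p+1, p+2, a+1, a+2, k, k+1`.
  refine ⟨_, _, _, _, _, _, _, _, _, _, _, hN₃ p hp3, hLm (Nat.le_succ p), hLm hpa,
    hLm (Nat.le_succ a), hXm hak, hN₁ p hp1, hN₁ (p + 1) (by omega), hN₁ (a + 1) (by omega),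
    hN₁ k (by omega), hN₂ (p + 1) (by omega), hN₂ (a + 1) (by omega), hN₂ k (by omega), ?_, ?_⟩
  · have h1 := Real.log_le_log (hX _) hvol
    have := hX (a + 2); have := hX (k + 1)
    have := hL p; have := hL a; have := hL (a + 1); have := hL k
    rw [Real.log_mul (by positivity) (by positivity), Real.log_mul (by positivity) (by positivity),
      Real.log_mul (by positivity) (by positivity), Real.log_mul (by positivity) (by positivity),
      Real.log_mul (by positivity) (by positivity), Real.log_mul (by positivity) (by positivity)]
      at h1
    linarith
  · have := hX (a + 1); have := hX (p + 2); have := hL a; have := hL (p + 1)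
    have h1 := Real.log_le_log (by positivity) harea
    rw [Real.log_mul (by positivity) (by positivity), Real.log_mul (by positivity) (by positivity),
      Real.log_mul (by positivity) (by positivity)] at h1
    have h2 : Real.log 4 ≤ Real.log 480 := Real.log_le_log (by norm_num) (by norm_num)
    linarith

/-! ### The root of `f₁` and the bound on the ordinary exponent -/

theorem exists_root_le {f : ℝ → ℝ} (hf : Continuous f) (h0 : f 0 < 0) {y : ℝ} (hy : 0 < y)
    (hfy : 0 ≤ f y) : ∃ x, 0 < x ∧ x ≤ y ∧ f x = 0 := by
  obtain ⟨x, hx, hfx⟩ := intermediate_value_Icc hy.le hf.continuousOn ⟨h0.le, hfy⟩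
  refine ⟨x, lt_of_le_of_ne hx.1 fun h => ?_, hx.2, hfx⟩
  rw [← h] at hfx
  exact h0.ne hfx

/-- Once `f₁` is nonpositive at a point, it is negative at all smaller positive points. -/
theorem f₁_neg_of_lt {w x y : ℝ} (hx : 0 < x) (hxy : x < y) (hy : f₁ w y ≤ 0) : f₁ w x < 0 := by
  unfold f₁ at *
  set β := w / (1 - w)
  have hy0 : 0 < y := hx.trans hxy
  have h1 : y ^ 3 * (x ^ 2 + x + 1) ≤ β * (y ^ 2 + y + 1) * (x ^ 2 + x + 1) :=
    mul_le_mul_of_nonneg_right (by linarith) (by positivity)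
  -- This is strict monotonicity of `x³ / (x² + x + 1)`, whose comparison with `β` decides the sign
  -- of `f₁`.
  have h2 : x ^ 3 * (y ^ 2 + y + 1) < y ^ 3 * (x ^ 2 + x + 1) := by
    have e : y ^ 3 * (x ^ 2 + x + 1) - x ^ 3 * (y ^ 2 + y + 1) =
        (y - x) * (x ^ 2 * y ^ 2 + x * y * (x + y) + (x ^ 2 + x * y + y ^ 2)) := by ring
    have : 0 < (y - x) * (x ^ 2 * y ^ 2 + x * y * (x + y) + (x ^ 2 + x * y + y ^ 2)) :=
      mul_pos (sub_pos.2 hxy) (by positivity)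
    linarith
  have h3 : x ^ 3 < β * (x ^ 2 + x + 1) := by
    refine lt_of_mul_lt_mul_right (a := y ^ 2 + y + 1) ?_ (by positivity)
    linarith
  linarith

theorem exists_isUniquePosRoot_f₁ {w : ℝ} (hw : 0 < w) (hw1 : w < 1) :
    ∃ G, IsUniquePosRoot (f₁ w) G := by
  have hβ : 0 < w / (1 - w) := div_pos hw (by linarith)
  -- At `β + 1` the value of `f₁` is 1.
  obtain ⟨G, hG, -, hfG⟩ := exists_root_le (f := f₁ w) (by unfold f₁; fun_prop)
    (by unfold f₁; linarith) (y := w / (1 - w) + 1) (by linarith)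
    (by unfold f₁; ring_nf; norm_num)
  refine ⟨G, hG, hfG, fun x hx hfx => ?_⟩
  rcases lt_trichotomy x G with h | h | h
  · exact absurd hfx (f₁_neg_of_lt hx h hfG.le).ne
  · exact h
  · exact absurd hfG (f₁_neg_of_lt hG h hfx.le).ne

/-- The root of `f₁` bounds the ratio of the exponents for every index `n ≥ 1`. -/
theorem mul_root_le_ordinaryExponent (hΘ : LinearIndependent ℤ (Fin.cons 1 Θ : Fin 5 → ℝ)) {n : ℕ}
    (hn : 1 ≤ n) (hconf : HasConfigurations Θ n) {w G : ℝ} (hw : 0 < w) (hw1 : w < 1)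
    (hwΘ : uniformExponent Θ = (w : EReal)) (hG : IsUniquePosRoot (f₁ w) G) :
    ((w * G : ℝ) : EReal) ≤ ordinaryExponent Θ := by
  by_contra! hlt
  obtain ⟨ρ, hρ, hρG⟩ := EReal.lt_iff_exists_real_btwn.1 hlt
  rw [EReal.coe_lt_coe_iff, mul_comm, ← div_lt_iff₀ hw] at hρG
  obtain ⟨g, hg, hgG⟩ := exists_between (max_lt hρG hG.1)
  have hg0 : 0 < g := (le_max_right _ _).trans_lt hg
  have hρg : ρ < w * g := by
    rw [mul_comm, ← div_lt_iff₀ hw]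
    exact (le_max_left _ _).trans_lt hg
  have hneg := f₁_neg_of_lt hg0 hgG hG.2.1.le
  -- The estimate needs `α` strictly below `w`; continuity keeps both strict inequalities for `α`
  -- close to `w`.
  have hcont : ContinuousAt (fun α => f₁ α g) w := by
    unfold f₁
    have : 1 - w ≠ 0 := by linarith
    fun_prop (disch := assumption)
  have e1 : ∀ᶠ α in nhdsWithin w (Set.Iio w), f₁ α g < 0 :=
    nhdsWithin_le_nhds (hcont.eventually_lt continuousAt_const hneg)
  have e2 : ∀ᶠ α in nhdsWithin w (Set.Iio w), ρ < α * g :=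
    nhdsWithin_le_nhds ((continuousAt_const (y := ρ)).eventually_lt
      (continuousAt_id.mul continuousAt_const) hρg)
  have e3 : ∀ᶠ α in nhdsWithin w (Set.Iio w), 0 < α := nhdsWithin_le_nhds (lt_mem_nhds hw)
  obtain ⟨α, ⟨⟨h1, h2⟩, h3⟩, h4⟩ := (((e1.and e2).and e3).and self_mem_nhdsWithin).exists
  have h4' : α < w := h4
  refine absurd (f₁_nonneg hΘ hn hconf h3 (h4'.trans hw1) hg0 ?_ ?_) (not_le.2 h1)
  · rw [hwΘ]
    exact EReal.coe_lt_coe_iff.2 h4'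
  · exact hρ.trans (EReal.coe_lt_coe_iff.2 h2)

theorem ordinaryExponent_eq_top (hΘ : LinearIndependent ℤ (Fin.cons 1 Θ : Fin 5 → ℝ)) {n : ℕ}
    (hn : 1 ≤ n) (hconf : HasConfigurations Θ n) (h1 : uniformExponent Θ = 1) :
    ordinaryExponent Θ = ⊤ := by
  by_contra hne
  obtain ⟨ρ, hρ, -⟩ := EReal.lt_iff_exists_real_btwn.1 (lt_top_iff_ne_top.2 hne)
  set g : ℝ := 2 * max ρ 1 with hg
  have hg0 : 2 ≤ g := by linarith [le_max_right ρ 1]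
  have hgρ : 2 * ρ ≤ g := by linarith [le_max_left ρ 1]
  -- Then `β = g³ - 1`, and `f₁ α g = g³ - (g³ - 1)(g² + g + 1)` is negative, while `α * g` still
  -- exceeds `ρ`.
  set α : ℝ := 1 - 1 / g ^ 3 with hα
  have hg3 : 8 ≤ g ^ 3 := by
    calc (8 : ℝ) = 2 ^ 3 := by norm_num
      _ ≤ g ^ 3 := by gcongr
  have hsmall : 1 / g ^ 3 ≤ 1 / 8 := one_div_le_one_div_of_le (by norm_num) hg3
  have hpos : 0 < 1 / g ^ 3 := by positivity
  have h := f₁_nonneg hΘ hn hconf (α := α) (g := g) (by linarith) (by linarith) (by linarith)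
    (by rw [h1]; exact_mod_cast (show α < 1 by linarith))
    (hρ.trans_le (EReal.coe_le_coe_iff.2 (by nlinarith)))
  have e : α / (1 - α) = g ^ 3 - 1 := by
    have : g ≠ 0 := by linarith
    rw [hα]
    field_simp
    ring
  unfold f₁ at h
  rw [e] at h
  nlinarith

/-! ### Comparison with the roots of the other polynomials -/

/-- At the root `x` of `f₁` the parameter is `w / (1 - w) = x³ / (x² + x + 1)`. -/
theorem one_le_root_f₁ {w x : ℝ} (hw : 1 / 4 ≤ w) (hw1 : w < 1) (hx : 0 < x) (h : f₁ w x = 0) :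
    1 ≤ x ∧ w / (1 - w) = x ^ 3 / (x ^ 2 + x + 1) ∧
      w / (1 - w) ^ 2 = x ^ 3 / (x ^ 2 + x + 1) * (x ^ 3 / (x ^ 2 + x + 1) + 1) := by
  have hs : 0 < x ^ 2 + x + 1 := by positivity
  have hw' : 0 < 1 - w := by linarith
  have hβ : 1 / 3 ≤ w / (1 - w) := by
    rw [le_div_iff₀ hw']; linarith
  have e : w / (1 - w) = x ^ 3 / (x ^ 2 + x + 1) := by
    rw [eq_div_iff hs.ne']
    unfold f₁ at h
    linarith
  have e' : w / (1 - w) ^ 2 = w / (1 - w) * (w / (1 - w) + 1) := by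
    field_simp
    ring
  refine ⟨?_, e, e' ▸ e ▸ rfl⟩
  rw [e, div_le_div_iff₀ (by norm_num) hs] at hβ
  by_contra! hlt
  nlinarith [mul_pos hx hx]

theorem f₂₁_nonneg {w x : ℝ} (hw : 1 / 4 ≤ w) (hw1 : w < 1) (hx : 0 < x) (h : f₁ w x = 0) :
    0 ≤ f₂₁ w x := by
  obtain ⟨h1, e, e'⟩ := one_le_root_f₁ hw hw1 hx h
  have hs : 0 < x ^ 2 + x + 1 := by positivity
  have : f₂₁ w x = x ^ 3 * (x - 1) * ((x + 1) * (x ^ 2 + 1)) / (x ^ 2 + x + 1) ^ 2 := by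
    unfold f₂₁
    rw [e, e']
    field_simp
    ring
  rw [this]
  have := sub_nonneg.2 h1
  positivity

theorem f₃_nonneg {w x : ℝ} (hw : 1 / 4 ≤ w) (hw1 : w < 1) (hx : 0 < x) (h : f₁ w x = 0) :
    0 ≤ f₃ w x := by
  obtain ⟨h1, e, e'⟩ := one_le_root_f₁ hw hw1 hx h
  have hs : 0 < x ^ 2 + x + 1 := by positivity
  have : f₃ w x = x ^ 3 * (x - 1) * (x + 1) * ((x + 1) * (x ^ 2 + 1)) / (x ^ 2 + x + 1) ^ 2 := by
    unfold f₃
    rw [← div_pow, e, e']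
    field_simp
    ring
  rw [this]
  have := sub_nonneg.2 h1
  positivity

/-- Subtracting `x * f₁` from `f₂₂` leaves `β (2x - β - 1)`, and `x > β ≥ 1` at a positive root of
`f₁`. -/
theorem f₂₂_nonneg {w x : ℝ} (hw : 1 / 2 ≤ w) (hw1 : w < 1) (hx : 0 < x) (h : f₁ w x = 0) :
    0 ≤ f₂₂ w x := by
  have hw' : 0 < 1 - w := by linarith
  have e' : w / (1 - w) ^ 2 = w / (1 - w) * (w / (1 - w) + 1) := by
    field_simp
    ring
  unfold f₂₂
  unfold f₁ at h
  have hβ : 1 ≤ w / (1 - w) := by rw [le_div_iff₀ hw']; linarith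
  rw [e']
  set β := w / (1 - w)
  have hxβ : β < x := by
    by_contra! hle
    nlinarith [mul_nonneg (mul_pos hx hx).le (sub_nonneg.2 hle)]
  have : x ^ 4 - β * x ^ 3 - β * x ^ 2 + β * x - β * (β + 1) = β * (2 * x - β - 1) := by
    linear_combination x * h
  rw [this]
  exact mul_nonneg (by linarith) (by linarith)

theorem exists_isUniquePosRoot_f₂₁ {w y : ℝ} (hw : 0 < w) (hw2 : w ≤ 1 / 2) (hy : 0 < y)
    (hfy : 0 ≤ f₂₁ w y) : ∃ G ≤ y, IsUniquePosRoot (f₂₁ w) G := by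
  have hw' : 0 < 1 - w := by linarith
  have hβ : 0 < w / (1 - w) := div_pos hw hw'
  have hβ1 : w / (1 - w) ≤ 1 := by rw [div_le_one hw']; linarith
  have e : ∀ x, f₂₁ w x = x * ((x - w / (1 - w)) * (x ^ 2 - w / (1 - w))) -
      w / (1 - w) * (w / (1 - w) + 1) := fun x => by
    unfold f₂₁
    field_simp
    ring
  obtain ⟨G, hG, hGy, hfG⟩ := exists_root_le (f := f₂₁ w) (by unfold f₂₁; fun_prop)
    (by rw [e]; nlinarith) hy hfy
  refine ⟨G, hGy, hG, hfG, fun x hx hfx => ?_⟩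
  rw [e] at hfx hfG
  set β := w / (1 - w)
  -- At a root the two factors have the same sign. If both were negative, then `x < β ≤ 1` would
  -- make the product at most `β²`, too small for `β (β + 1)`. With both positive, the product
  -- increases.
  have large : ∀ x, 0 < x → x * ((x - β) * (x ^ 2 - β)) - β * (β + 1) = 0 →
      0 < x - β ∧ 0 < x ^ 2 - β := by
    intro x hx h
    have hp : 0 < (x - β) * (x ^ 2 - β) := by
      refine pos_of_mul_pos_right (a := x) ?_ hx.le
      nlinarith
    rcases pos_and_pos_or_neg_and_neg_of_mul_pos hp with h' | ⟨h1, h2⟩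
    · exact h'
    · have i1 : (β - x) * (β - x ^ 2) ≤ β * β :=
        mul_le_mul (by linarith) (by nlinarith) (by linarith) hβ.le
      have i2 : x * ((β - x) * (β - x ^ 2)) ≤ 1 * (β * β) :=
        mul_le_mul (by linarith) i1 (by nlinarith) zero_le_one
      nlinarith
  have mono : ∀ a b, 0 < a → a < b → a * ((a - β) * (a ^ 2 - β)) - β * (β + 1) = 0 →
      b * ((b - β) * (b ^ 2 - β)) - β * (β + 1) ≠ 0 := by
    intro a b ha hab h h'
    obtain ⟨h1, h2⟩ := large a ha h
    have hsq : a ^ 2 < b ^ 2 := by nlinarith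
    have : a * ((a - β) * (a ^ 2 - β)) < b * ((b - β) * (b ^ 2 - β)) := by
      have i : (a - β) * (a ^ 2 - β) < (b - β) * (b ^ 2 - β) :=
        mul_lt_mul'' (by linarith) (by linarith) h1.le h2.le
      exact mul_lt_mul'' hab i ha.le (mul_pos h1 h2).le
    linarith
  rcases lt_trichotomy x G with h | h | h
  · exact absurd hfG (mono x G hx h hfx)
  · exact h
  · exact absurd hfx (mono G x hG h hfG)

theorem exists_isUniquePosRoot_f₂₂ {w y : ℝ} (hw : 0 < w) (hw1 : w < 1) (hy : 0 < y)
    (hfy : 0 ≤ f₂₂ w y) : ∃ G ≤ y, IsUniquePosRoot (f₂₂ w) G := by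
  have hw' : 0 < 1 - w := by linarith
  have hβ : 0 < w / (1 - w) := div_pos hw hw'
  have e : ∀ x, f₂₂ w x = x ^ 2 * (x ^ 2 - w / (1 - w) * x - w / (1 - w)) +
      w / (1 - w) * (x - w / (1 - w) - 1) := fun x => by
    unfold f₂₂
    field_simp
    ring
  obtain ⟨G, hG, hGy, hfG⟩ := exists_root_le (f := f₂₂ w) (by unfold f₂₂; fun_prop)
    (by rw [e]; nlinarith) hy hfy
  refine ⟨G, hGy, hG, hfG, fun x hx hfx => ?_⟩
  rw [e] at hfx hfG
  set β := w / (1 - w)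
  have mono : ∀ a b, 0 < a → a < b → a ^ 2 * (a ^ 2 - β * a - β) + β * (a - β - 1) = 0 →
      b ^ 2 * (b ^ 2 - β * b - β) + β * (b - β - 1) ≠ 0 := by
    intro a b ha hab h h'
    -- If this failed, then `a < β + 1` and both summands would be nonpositive, the second strictly
    -- negative.
    have h1 : 0 < a ^ 2 - β * a - β := by
      by_contra! hle
      have i1 : a - β - 1 < 0 := by
        by_contra! hge
        nlinarith
      have i2 := mul_nonneg (sq_nonneg a) (neg_nonneg.2 hle)
      nlinarith
    have h2 : β < a := by
      by_contra! hle
      nlinarith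
    have h3 : a ^ 2 - β * a - β < b ^ 2 - β * b - β := by nlinarith
    have h4 : a ^ 2 * (a ^ 2 - β * a - β) < b ^ 2 * (b ^ 2 - β * b - β) :=
      mul_lt_mul'' (by nlinarith) h3 (sq_nonneg a) h1.le
    nlinarith
  rcases lt_trichotomy x G with h | h | h
  · exact absurd hfG (mono x G hx h hfx)
  · exact h
  · exact absurd hfx (mono G x hG h hfG)

/-- Beyond `y` both `x - β` and `x² - β` are positive and increasing, so `f₃` has no root there; the
roots in `[0, y]` form a compact set. -/
theorem exists_isLargestPosRoot_f₃ {w y : ℝ} (hw : 0 < w) (hw1 : w < 1) (hy : 0 < y)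
    (hyβ : w / (1 - w) < y) (hyβ' : w / (1 - w) < y ^ 2)
    (hfy : 0 ≤ f₃ w y) : ∃ G ≤ y, IsLargestPosRoot (f₃ w) G := by
  have hw' : 0 < 1 - w := by linarith
  have hβ : 0 < w / (1 - w) := div_pos hw hw'
  have e : ∀ x, f₃ w x = x ^ 2 * ((x - w / (1 - w)) * (x ^ 2 - w / (1 - w))) -
      w / (1 - w) * (w / (1 - w) + 1) := fun x => by
    unfold f₃
    field_simp
    ring
  have h0 : f₃ w 0 < 0 := by rw [e]; nlinarith
  have hcont : Continuous (f₃ w) := by unfold f₃; fun_prop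
  obtain ⟨G₀, hG₀, hG₀y, hfG₀⟩ := exists_root_le hcont h0 hy hfy
  have hle : ∀ x, 0 < x → f₃ w x = 0 → x ≤ y := by
    intro x hx hfx
    by_contra! hlt
    rw [e] at hfx hfy
    have hsq : y ^ 2 < x ^ 2 := by nlinarith
    have i : (y - w / (1 - w)) * (y ^ 2 - w / (1 - w)) <
        (x - w / (1 - w)) * (x ^ 2 - w / (1 - w)) :=
      mul_lt_mul'' (by linarith) (by linarith) (by linarith) (by linarith)
    have := mul_lt_mul'' hsq i (sq_nonneg y)
      (mul_pos (sub_pos.2 hyβ) (sub_pos.2 hyβ')).le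
    linarith
  have hcomp : IsCompact (Set.Icc 0 y ∩ {x | f₃ w x = 0}) :=
    isCompact_Icc.inter_right (isClosed_eq hcont continuous_const)
  obtain ⟨G, ⟨hG, hfG⟩, hmax⟩ := hcomp.exists_isGreatest ⟨G₀, ⟨hG₀.le, hG₀y⟩, hfG₀⟩
  have hGpos : 0 < G := hG₀.trans_le (hmax ⟨⟨hG₀.le, hG₀y⟩, hfG₀⟩)
  exact ⟨G, hG.2, ⟨hGpos, hfG⟩, fun x hx => hmax ⟨⟨hx.1.le, hle x hx.1 hx.2⟩, hx.2⟩⟩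

/-! ### From the index to the theorem -/

theorem hasConfigurations_of_index_eq {n : ℕ} (h : index Θ = n) : HasConfigurations Θ n := by
  by_contra hn
  have hle : ((n + 1 : ℕ) : ℕ∞) ≤ index Θ := by
    refine le_iInf₂ fun m hm => ?_
    have hnm : (n : ℕ∞) ≤ m := h ▸ iInf₂_le m hm
    have hne : n ≠ m := fun e => hn (e ▸ hm)
    have hnm' : n ≤ m := by exact_mod_cast hnm
    exact_mod_cast Nat.lt_of_le_of_ne hnm' hne
  rw [h] at hle
  have : n + 1 ≤ n := by exact_mod_cast hle
  omega

/-- All roots occurring in the bounds are at most the root of `f₁`, which is attained by the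
exponents for every index `n ≥ 1`. -/
theorem exists_root_f₁_bound (hΘ : LinearIndependent ℤ (Fin.cons 1 Θ : Fin 5 → ℝ)) {n : ℕ}
    (hn : 1 ≤ n) (hi : index Θ = n) (hlt : uniformExponent Θ < 1) :
    1 / 4 ≤ (uniformExponent Θ).toReal ∧ (uniformExponent Θ).toReal < 1 ∧
      ∃ G, IsUniquePosRoot (f₁ (uniformExponent Θ).toReal) G ∧
        ∀ x ≤ G, uniformExponent Θ * (x : EReal) ≤ ordinaryExponent Θ := by
  have hq := quarter_le_uniformExponent Θ
  have hw : ((uniformExponent Θ).toReal : EReal) = uniformExponent Θ :=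
    EReal.coe_toReal (ne_top_of_lt hlt) (ne_bot_of_gt ((EReal.bot_lt_coe _).trans_le hq))
  have h4 : 1 / 4 ≤ (uniformExponent Θ).toReal := by
    rw [← hw, EReal.coe_le_coe_iff] at hq
    exact hq
  have h1 : (uniformExponent Θ).toReal < 1 := by
    rw [← hw] at hlt
    exact_mod_cast hlt
  obtain ⟨G, hG⟩ := exists_isUniquePosRoot_f₁ (by linarith) h1
  refine ⟨h4, h1, G, hG, fun x hx => ?_⟩
  refine le_trans ?_ (mul_root_le_ordinaryExponent hΘ hn (hasConfigurations_of_index_eq hi)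
    (by linarith) h1 hw.symm hG)
  rw [← hw, ← EReal.coe_mul, EReal.toReal_coe, EReal.coe_le_coe_iff]
  exact mul_le_mul_of_nonneg_left hx (by linarith)

end DiophantineFour

theorem theorem1 (Θ : Fin 4 → ℝ)
    (hΘ : LinearIndependent ℤ (Fin.cons 1 Θ : Fin 5 → ℝ)) :
    (DiophantineFour.index Θ = 1 →
      DiophantineFour.uniformExponent Θ < 1 →
      ∃ G : ℝ, DiophantineFour.IsUniquePosRoot
          (DiophantineFour.f₁ (DiophantineFour.uniformExponent Θ).toReal) G ∧
        DiophantineFour.uniformExponent Θ * (G : EReal) ≤ DiophantineFour.ordinaryExponent Θ) ∧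
    (DiophantineFour.index Θ = 2 →
      DiophantineFour.uniformExponent Θ < 1 →
      ((DiophantineFour.uniformExponent Θ).toReal ≤ 1 / 2 →
        ∃ G : ℝ, DiophantineFour.IsUniquePosRoot
            (DiophantineFour.f₂₁ (DiophantineFour.uniformExponent Θ).toReal) G ∧
          DiophantineFour.uniformExponent Θ * (G : EReal) ≤ DiophantineFour.ordinaryExponent Θ) ∧
      (1 / 2 ≤ (DiophantineFour.uniformExponent Θ).toReal →
        ∃ G : ℝ, DiophantineFour.IsUniquePosRoot
            (DiophantineFour.f₂₂ (DiophantineFour.uniformExponent Θ).toReal) G ∧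
          DiophantineFour.uniformExponent Θ * (G : EReal) ≤
            DiophantineFour.ordinaryExponent Θ)) ∧
    (DiophantineFour.index Θ = 3 →
      DiophantineFour.uniformExponent Θ < 1 →
      ∃ G : ℝ, DiophantineFour.IsLargestPosRoot
          (DiophantineFour.f₃ (DiophantineFour.uniformExponent Θ).toReal) G ∧
        DiophantineFour.uniformExponent Θ * (G : EReal) ≤ DiophantineFour.ordinaryExponent Θ) ∧
    (DiophantineFour.index Θ = 1 ∨ DiophantineFour.index Θ = 2 ∨ DiophantineFour.index Θ = 3 →
      DiophantineFour.uniformExponent Θ = 1 →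
      DiophantineFour.ordinaryExponent Θ = ⊤) := by
  open DiophantineFour in
  refine ⟨fun hi hlt => ?_, fun hi hlt => ⟨fun hw2 => ?_, fun hw2 => ?_⟩, fun hi hlt => ?_, ?_⟩
  · obtain ⟨-, -, G, hG, hle⟩ := exists_root_f₁_bound hΘ (n := 1) le_rfl hi hlt
    exact ⟨G, hG, hle G le_rfl⟩
  · obtain ⟨hw, hw1, G, hG, hle⟩ := exists_root_f₁_bound hΘ (n := 2) (by omega) hi hlt
    obtain ⟨G', hG', hroot⟩ := exists_isUniquePosRoot_f₂₁ (by linarith) hw2 hG.1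
      (f₂₁_nonneg hw hw1 hG.1 hG.2.1)
    exact ⟨G', hroot, hle G' hG'⟩
  · obtain ⟨-, hw1, G, hG, hle⟩ := exists_root_f₁_bound hΘ (n := 2) (by omega) hi hlt
    obtain ⟨G', hG', hroot⟩ := exists_isUniquePosRoot_f₂₂ (by linarith) hw1 hG.1
      (f₂₂_nonneg hw2 hw1 hG.1 hG.2.1)
    exact ⟨G', hroot, hle G' hG'⟩
  · obtain ⟨hw, hw1, G, hG, hle⟩ := exists_root_f₁_bound hΘ (n := 3) (by omega) hi hlt
    obtain ⟨hG1, e, -⟩ := one_le_root_f₁ hw hw1 hG.1 hG.2.1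
    -- `β = G³ / (G² + G + 1)` is below `G`, hence below `G²` as `G ≥ 1`.
    have hβ : ((uniformExponent Θ).toReal / (1 - (uniformExponent Θ).toReal)) < G := by
      rw [e, div_lt_iff₀ (by positivity)]
      nlinarith
    obtain ⟨G', hG', hroot⟩ := exists_isLargestPosRoot_f₃ (by linarith) hw1 hG.1 hβ
      (by nlinarith) (f₃_nonneg hw hw1 hG.1 hG.2.1)
    exact ⟨G', hroot, hle G' hG'⟩
  · rintro (hi | hi | hi) h1
    · exact ordinaryExponent_eq_top hΘ le_rfl (hasConfigurations_of_index_eq (n := 1) hi) h1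
    · exact ordinaryExponent_eq_top hΘ (by omega) (hasConfigurations_of_index_eq (n := 2) hi) h1
    · exact ordinaryExponent_eq_top hΘ (by omega) (hasConfigurations_of_index_eq (n := 3) hi) h1
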